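/- For an integer matrix $A\in\mathbb{Z}^{d\times n}$ and $c\in\mathbb{Q}^n$, consider for $b\in\mathbb{Z}^d$ the integer program of minimizing $c\cdot u$ subject to $Au=b$, $u\ge 0$, $u\in\mathbb{Z}^n$, and its linear relaxation, in which $u\in\mathbb{R}^n$. Let $\mathrm{gap}(A,c)$ be the maximum of (optimal value of the integer program) $-$ (optimal value of the linear relaxation) over all $b$ for which the integer program is feasible and bounded. A hierarchical model for $2\times2\times2\times2$ tables $u=(u_{ijkl})_{i,j,k,l\in\{1,2\}}$ is given by a nonempty collection $F_1,\dots,F_k$ of subsets of $\{1,2,3,4\}$. Let $A$ be the zero-one matrix with $16$ columns of the linear map that sends a table $u$ to its $F_1$-, …, $F_k$-marginals, where the $F$-marginal is obtained by summing the entries of $u$ over all indices in positions outside $F$. Put $\mathrm{gap}_+(A)=\mathrm{gap}(A,c)$, where $c=(-1,0,\dots,0)$ has the entry $-1$ at the cell $1111$ (so that $u_{1111}$ is maximized subject to fixed marginals). **Proposition 4.2.** For every hierarchical model for $2\times 2\times 2\times 2$ tables, the maximum defining $\mathrm{gap}_+(A)$ exists and $$\mathrm{gap}_+(A)\le \tfrac53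 .$$ Moreover $\mathrm{gap}_+(A)=\tfrac53$ for the $K_4$-model, which is given by the six two-element subsets $\{1,2\},\{1,3\},\{1,4\},\{2,3\},\{2,4\},\{3,4\}$. -/

import Mathlib

/-! Integer programs in standard form, their linear relaxations, and the integer programming gap. -/

/-- The objective values `c · u` of the feasible solutions of the integer program
"minimize `c · u` subject to `A u = b`, `u ≥ 0`, `u` integral". -/
def ipValues {ρ κ : Type*} [Fintype κ] (A : Matrix ρ κ ℤ) (c : κ → ℚ) (b : ρ → ℤ) : Set ℝ :=
  {t | ∃ u : κ → ℤ, (∀ j, 0 ≤ u j) ∧ (∀ i, ∑ j, A i j * u j = b i) ∧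
    t = ∑ j, (c j : ℝ) * (u j : ℝ)}

/-- The objective values `c · v` of the feasible solutions of the linear programming relaxation
"minimize `c · v` subject to `A v = b`, `v ≥ 0`" (`v` real). -/
def lpValues {ρ κ : Type*} [Fintype κ] (A : Matrix ρ κ ℤ) (c : κ → ℚ) (b : ρ → ℤ) : Set ℝ :=
  {t | ∃ v : κ → ℝ, (∀ j, 0 ≤ v j) ∧ (∀ i, ∑ j, (A i j : ℝ) * v j = (b i : ℝ)) ∧
    t = ∑ j, (c j : ℝ) * v j}

/-- All differences (optimal value of the integer program) - (optimal value of the linear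
relaxation), where `b` ranges over the right hand sides for which the integer program is feasible
and bounded. For such `b` the linear relaxation is feasible and bounded as well (`A` and `c` are
rational), so both infima are optimal values. -/
def gapSet {ρ κ : Type*} [Fintype κ] (A : Matrix ρ κ ℤ) (c : κ → ℚ) : Set ℝ :=
  {δ | ∃ b : ρ → ℤ, (ipValues A c b).Nonempty ∧ BddBelow (ipValues A c b) ∧
    δ = sInf (ipValues A c b) - sInf (lpValues A c b)}

/-- The integer programming gap `gap(A, c)`: the largest element of `gapSet A c`. (That the
supremum is a maximum is asserted separately where it is used.) -/
noncomputable def gap {ρ κ : Type*} [Fintype κ] (A : Matrix ρ κ ℤ) (c : κ → ℚ) : ℝ :=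
  sSup (gapSet A c)

/-! Hierarchical models for contingency tables. -/

/-- The cells of a `d₁ × ⋯ × dₙ` table; the values `1, …, dⱼ` are written as `0, …, dⱼ - 1`. -/
abbrev Cell {n : ℕ} (d : Fin n → ℕ) : Type := (j : Fin n) → Fin (d j)

/-- The entries of all marginals of a table: a member `F` of the collection `𝓕`, together with a
cell of the `F`-marginal. -/
abbrev MarginCell {n : ℕ} (d : Fin n → ℕ) (𝓕 : Finset (Finset (Fin n))) : Type :=
  (F : {F : Finset (Fin n) // F ∈ 𝓕}) × ((j : {j : Fin n // j ∈ F.1}) → Fin (d j.1))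

/-- The zero-one matrix of the hierarchical model `𝓕`, that is, of the linear map which sends a
table to its `F`-marginals, `F ∈ 𝓕`. -/
def modelMatrix {n : ℕ} (d : Fin n → ℕ) (𝓕 : Finset (Finset (Fin n))) :
    Matrix (MarginCell d 𝓕) (Cell d) ℤ :=
  fun r i => if (∀ j : {j : Fin n // j ∈ r.1.1}, i j.1 = r.2 j) then 1 else 0

/-- The cost vector `(-1, 0, …, 0)`: minimizing it means maximizing the entry `u_{1 1 ⋯ 1}`. -/
def maxFirstCellCost {n : ℕ} (d : Fin n → ℕ) [∀ j, NeZero (d j)] : Cell d → ℚ :=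
  fun i => if i = (fun _ => 0) then -1 else 0

/-- `gap₊(A)` for the hierarchical model `𝓕` on `d₁ × ⋯ × dₙ` tables. -/
noncomputable def gapPlus {n : ℕ} (d : Fin n → ℕ) [∀ j, NeZero (d j)]
    (𝓕 : Finset (Finset (Fin n))) : ℝ :=
  gap (modelMatrix d 𝓕) (maxFirstCellCost d)

/-- The format of `2 × 2 × 2 × 2` tables. -/
abbrev twoTwoTwoTwo : Fin 4 → ℕ := fun _ => 2

/-- The `K₄`-model: all six two-dimensional margins (the ground set `{1,2,3,4}` is `Fin 4`). -/
def K4Model : Finset (Finset (Fin 4)) :=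
  {{0, 1}, {0, 2}, {0, 3}, {1, 2}, {1, 3}, {2, 3}}

/-! Only the simplicial complex `Δ` generated by the model matters, since fixing a marginal fixes
all coarser ones. A bound `g` on the gap means this: if a real table `v` beats an integral table `u`
with the same marginals by more than `g` in the first cell, then `u` is not optimal. The proof shows
that every gap is `0`, `1` or `5/3`.

If some edge is missing from the graph of `Δ`, the gap is `0`. Gap zero is preserved by gluing two
complexes along a common face (`GapAtMost.union`). Splitting at missing edges leaves faces, single
vertices, the boundary of a triangle and the 4-cycle. For the last two, the difference `v - u` is
rounded explicitly to an integral move.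

If all edges are present and the full set is not a face, the tables with vanishing pair marginals
form a five-dimensional space. Identify the 16 cells with the subsets of a five-element set up to
complement: the empty set, five singletons and ten pairs. Such a table then has entries `s`, `-a i`
and `a i + a j - s`, where `∑ a i = 3 s`. This shows a symmetry under all permutations of five
parameters. Each three-element face forces one parameter to equal `s`. A short case analysis
(`exists_moveAvailable`) finds an integral move as soon as `s` exceeds `5/3`, `1` or `0`, according
to whether no, one or more parameters are bound. The critical estimate is that the largest `a i` is
at least `3 s / 5`, which exceeds `1` exactly when `s > 5/3`.

The values `5/3` and `1` are attained at the table with ones at the five singleton cells. Its first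
entry `0` is optimal among integral tables, while real tables reach `5/3`, or `1` when one parameter
is bound. -/

open Finset

/-- The `F`-marginal of a table, written as a function of all the coordinates of a cell. -/
def margin {n : ℕ} {d : Fin n → ℕ} {R : Type*} [AddCommMonoid R] (F : Finset (Fin n))
    (u : Cell d → R) (x : Cell d) : R :=
  ∑ y with ∀ j ∈ F, y j = x j, u y

/-! ### Marginals of tables and their coarsening -/

section Margin

variable {n : ℕ} {d : Fin n → ℕ} {R : Type*}

theorem margin_add [AddCommMonoid R] (F : Finset (Fin n)) (u v : Cell d → R) (x : Cell d) :
    margin F (fun y => u y + v y) x = margin F u x + margin F v x :=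
  Finset.sum_add_distrib

theorem margin_sub [AddCommGroup R] (F : Finset (Fin n)) (u v : Cell d → R) (x : Cell d) :
    margin F (fun y => u y - v y) x = margin F u x - margin F v x :=
  Finset.sum_sub_distrib _ _

theorem margin_intCast (F : Finset (Fin n)) (u : Cell d → ℤ) (x : Cell d) :
    margin F (fun y => (u y : ℝ)) x = ((margin F u x : ℤ) : ℝ) := by
  simp [margin]

theorem margin_univ [AddCommMonoid R] (u : Cell d → R) (x : Cell d) :
    margin univ u x = u x := by
  have : (univ.filter fun y : Cell d => ∀ j ∈ (univ : Finset (Fin n)), y j = x j) = {x} := by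
    ext y; simp [funext_iff]
  rw [margin, this, sum_singleton]

theorem margin_congr [AddCommMonoid R] {F : Finset (Fin n)} (u : Cell d → R) {x y : Cell d}
    (h : ∀ j ∈ F, x j = y j) : margin F u x = margin F u y := by
  unfold margin
  congr 1
  ext z
  simp only [mem_filter, mem_univ, true_and]
  exact forall₂_congr fun j hj => by rw [h j hj]

theorem margin_nonneg [AddCommMonoid R] [PartialOrder R] [IsOrderedAddMonoid R]
    (F : Finset (Fin n)) {u : Cell d → R} (hu : ∀ y, 0 ≤ u y) (x : Cell d) : 0 ≤ margin F u x :=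
  Finset.sum_nonneg fun y _ => hu y

theorem margin_anti [AddCommMonoid R] [PartialOrder R] [IsOrderedAddMonoid R]
    {F G : Finset (Fin n)} (h : F ⊆ G) {u : Cell d → R} (hu : ∀ y, 0 ≤ u y) (x : Cell d) :
    margin G u x ≤ margin F u x :=
  Finset.sum_le_sum_of_subset_of_nonneg
    (fun y hy => by
      simp only [mem_filter, mem_univ, true_and] at hy ⊢
      exact fun j hj => hy j (h hj))
    fun y _ _ => hu y

/-- A marginal is obtained from a finer one by summing over representatives. -/
theorem margin_margin [AddCommMonoid R] [∀ j, NeZero (d j)] {F G : Finset (Fin n)} (h : F ⊆ G)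
    (u : Cell d → R) (x : Cell d) :
    margin F u x =
      ∑ z with (∀ j, j ∉ G → z j = 0) ∧ ∀ j ∈ F, z j = x j, margin G u z := by
  unfold margin
  rw [Finset.sum_sigma']
  refine Finset.sum_bij' (fun y _ => ⟨fun j => if j ∈ G then y j else 0, y⟩) (fun p _ => p.2)
    ?_ ?_ ?_ ?_ ?_
  · intro y hy
    simp only [mem_filter, mem_univ, true_and, mem_sigma] at hy ⊢
    refine ⟨⟨fun j hj => by simp [hj], fun j hj => by simp [h hj, hy j hj]⟩,
      fun j hj => by simp [hj]⟩
  · rintro ⟨z, y⟩ hp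
    simp only [mem_filter, mem_univ, true_and, mem_sigma] at hp ⊢
    exact fun j hj => by rw [hp.2 j (h hj), hp.1.2 j hj]
  · intro y _; rfl
  · rintro ⟨z, y⟩ hp
    simp only [mem_filter, mem_univ, true_and, mem_sigma] at hp
    have : (fun j => if j ∈ G then y j else 0) = z := by
      funext j
      by_cases hj : j ∈ G
      · simp [hj, hp.2 j hj]
      · simp [hj, hp.1.1 j hj]
    simp [this]
  · intro y _; rfl

theorem margin_eq_of_subset [AddCommMonoid R] [∀ j, NeZero (d j)] {F G : Finset (Fin n)}
    (h : F ⊆ G) {u v : Cell d → R} (huv : ∀ x, margin G u x = margin G v x) (x : Cell d) :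
    margin F u x = margin F v x := by
  simp only [margin_margin h, huv]

end Margin

/-! ### From optimal values to comparing tables with equal marginals -/

section Gap

variable {n : ℕ} {d : Fin n → ℕ}

/-- Whenever a nonnegative integral table `u` and a nonnegative real table `v` have the same
`F`-marginals for the faces `F ⊆ V` of `Δ`, and the first entry of the `V`-marginal of `v` exceeds
that of `u` by more than `g`, the first entry of the `V`-marginal of `u` is not maximal among the
integral tables with these `F`-marginals. -/
def GapAtMost (d : Fin n → ℕ) [∀ j, NeZero (d j)] (V : Finset (Fin n))
    (Δ : Set (Finset (Fin n))) (g : ℝ) : Prop :=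
  ∀ (u : Cell d → ℤ) (v : Cell d → ℝ), (∀ x, 0 ≤ u x) → (∀ x, 0 ≤ v x) →
    (∀ F ∈ Δ, F ⊆ V → ∀ x, margin F v x = ((margin F u x : ℤ) : ℝ)) →
    ((margin V u (fun _ => 0) : ℤ) : ℝ) + g < margin V v (fun _ => 0) →
    ∃ u' : Cell d → ℤ, (∀ x, 0 ≤ u' x) ∧
      (∀ F ∈ Δ, F ⊆ V → ∀ x, margin F u' x = margin F u x) ∧
      margin V u (fun _ => 0) < margin V u' (fun _ => 0)

variable (𝓕 : Finset (Finset (Fin n)))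

theorem sum_modelMatrix_mul {R : Type*} [Ring R] [∀ j, NeZero (d j)] (r : MarginCell d 𝓕)
    (u : Cell d → R) :
    ∑ j, ((modelMatrix d 𝓕 r j : ℤ) : R) * u j =
      margin r.1.1 u (fun j => if h : j ∈ r.1.1 then r.2 ⟨j, h⟩ else 0) := by
  unfold margin modelMatrix
  rw [Finset.sum_filter]
  refine Finset.sum_congr rfl fun y _ => ?_
  have : (∀ j : {j // j ∈ r.1.1}, y j.1 = r.2 j) ↔
      ∀ j ∈ r.1.1, y j = if h : j ∈ r.1.1 then r.2 ⟨j, h⟩ else 0 := by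
    constructor
    · intro h j hj; simp [hj, h ⟨j, hj⟩]
    · rintro h ⟨j, hj⟩; simpa [hj] using h j hj
  by_cases hy : ∀ j : {j // j ∈ r.1.1}, y j.1 = r.2 j
  · rw [if_pos hy, if_pos (this.1 hy)]; simp
  · rw [if_neg hy, if_neg (mt this.2 hy)]; simp

theorem sum_modelMatrix_eq_iff [∀ j, NeZero (d j)] (u : Cell d → ℤ) (v : Cell d → ℝ) :
    (∀ r, ∑ j, (modelMatrix d 𝓕 r j : ℝ) * v j = ((∑ j, modelMatrix d 𝓕 r j * u j : ℤ) : ℝ)) ↔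
      ∀ F ∈ lowerClosure (𝓕 : Set (Finset (Fin n))), ∀ x,
        margin F v x = ((margin F u x : ℤ) : ℝ) := by
  have key : ∀ r, ((∑ j, modelMatrix d 𝓕 r j * u j : ℤ) : ℝ) =
      ∑ j, (modelMatrix d 𝓕 r j : ℝ) * (u j : ℝ) := fun r => by push_cast; rfl
  simp only [key, sum_modelMatrix_mul 𝓕, ← margin_intCast]
  constructor
  · rintro h F ⟨G, hG, hFG⟩ x
    refine margin_eq_of_subset hFG (fun y => ?_) x
    have hy : ∀ j ∈ G, (if _ : j ∈ G then y j else 0) = y j := fun j hj => by simp [hj]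
    have := h ⟨⟨G, hG⟩, fun j => y j.1⟩
    rwa [margin_congr v hy, margin_congr _ hy] at this
  · intro h r
    exact h _ (subset_lowerClosure r.1.2) _

theorem sum_modelMatrix_int_eq_iff [∀ j, NeZero (d j)] (u u' : Cell d → ℤ) :
    (∀ r, ∑ j, modelMatrix d 𝓕 r j * u' j = ∑ j, modelMatrix d 𝓕 r j * u j) ↔
      ∀ F ∈ lowerClosure (𝓕 : Set (Finset (Fin n))), ∀ x, margin F u' x = margin F u x := by
  have := sum_modelMatrix_eq_iff 𝓕 u (fun j => (u' j : ℝ))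
  simp only [margin_intCast] at this
  exact_mod_cast this

theorem sum_maxFirstCellCost [∀ j, NeZero (d j)] (v : Cell d → ℝ) :
    ∑ j, (maxFirstCellCost d j : ℝ) * v j = -v (fun _ => 0) := by
  rw [Finset.sum_eq_single (fun _ => 0)]
  · simp [maxFirstCellCost]
  · intro b _ hb; simp [maxFirstCellCost, hb]
  · simp

theorem mem_ipValues_iff [∀ j, NeZero (d j)] (u : Cell d → ℤ) (t : ℝ) :
    t ∈ ipValues (modelMatrix d 𝓕) (maxFirstCellCost d)
        (fun r => ∑ j, modelMatrix d 𝓕 r j * u j) ↔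
      ∃ u' : Cell d → ℤ, (∀ x, 0 ≤ u' x) ∧
        (∀ F ∈ lowerClosure (𝓕 : Set (Finset (Fin n))), ∀ x, margin F u' x = margin F u x) ∧
        t = -(u' (fun _ => 0) : ℝ) := by
  simp only [ipValues, Set.mem_ofPred_eq, sum_modelMatrix_int_eq_iff,
    sum_maxFirstCellCost (fun j => _)]

theorem mem_lpValues_iff [∀ j, NeZero (d j)] (u : Cell d → ℤ) (t : ℝ) :
    t ∈ lpValues (modelMatrix d 𝓕) (maxFirstCellCost d)
        (fun r => ∑ j, modelMatrix d 𝓕 r j * u j) ↔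
      ∃ v : Cell d → ℝ, (∀ x, 0 ≤ v x) ∧
        (∀ F ∈ lowerClosure (𝓕 : Set (Finset (Fin n))), ∀ x,
          margin F v x = ((margin F u x : ℤ) : ℝ)) ∧
        t = -v (fun _ => 0) := by
  simp only [lpValues, Set.mem_ofPred_eq, sum_modelMatrix_eq_iff, sum_maxFirstCellCost]

theorem GapAtMost.le_of_mem_gapSet [∀ j, NeZero (d j)] {𝓕 : Finset (Finset (Fin n))} {g : ℝ}
    (hg : GapAtMost d univ (lowerClosure (𝓕 : Set (Finset (Fin n)))) g) {δ : ℝ}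
    (hδ : δ ∈ gapSet (modelMatrix d 𝓕) (maxFirstCellCost d)) : δ ≤ g := by
  obtain ⟨b, ⟨t, u₀, hu₀, hb, rfl⟩, hbdd, rfl⟩ := hδ
  obtain rfl : (fun r => ∑ j, modelMatrix d 𝓕 r j * u₀ j) = b := funext hb
  obtain ⟨B, hB⟩ := hbdd
  have hmax := Int.exists_greatest_of_bdd
    (P := fun m => ∃ u : Cell d → ℤ, (∀ x, 0 ≤ u x) ∧
      (∀ F ∈ lowerClosure (𝓕 : Set (Finset (Fin n))), ∀ x, margin F u x = margin F u₀ x) ∧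
      m = u (fun _ => 0))
    (by
      refine ⟨⌊-B⌋, ?_⟩
      rintro z ⟨u, hu, hm, rfl⟩
      have := hB ((mem_ipValues_iff 𝓕 u₀ _).2 ⟨u, hu, hm, rfl⟩)
      exact Int.le_floor.2 (by linarith))
    ⟨_, u₀, hu₀, fun _ _ _ => rfl, rfl⟩
  obtain ⟨_, ⟨u, hu, hm, rfl⟩, hopt⟩ := hmax
  have hip : sInf (ipValues (modelMatrix d 𝓕) (maxFirstCellCost d)
      (fun r => ∑ j, modelMatrix d 𝓕 r j * u₀ j)) = -(u (fun _ => 0) : ℝ) := by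
    refine IsLeast.csInf_eq ⟨(mem_ipValues_iff 𝓕 u₀ _).2 ⟨u, hu, hm, rfl⟩, ?_⟩
    intro t ht
    obtain ⟨u', hu', hm', rfl⟩ := (mem_ipValues_iff 𝓕 u₀ _).1 ht
    have := hopt _ ⟨u', hu', hm', rfl⟩
    exact neg_le_neg (by exact_mod_cast this)
  have hlp : -((u (fun _ => 0) : ℝ) + g) ≤ sInf (lpValues (modelMatrix d 𝓕) (maxFirstCellCost d)
      (fun r => ∑ j, modelMatrix d 𝓕 r j * u₀ j)) := by
    refine le_csInf ⟨_, (mem_lpValues_iff 𝓕 u₀ _).2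
      ⟨fun j => u₀ j, fun x => Int.cast_nonneg (hu₀ x), fun F _ x => margin_intCast F u₀ x, rfl⟩⟩ ?_
    intro t ht
    obtain ⟨v, hv, hvm, rfl⟩ := (mem_lpValues_iff 𝓕 u₀ _).1 ht
    by_contra! hlt
    obtain ⟨u', hu', hm', hgt⟩ := hg u v hu hv
      (fun F hF _ x => by rw [hvm F hF x, hm F hF x])
      (by simp only [margin_univ]; linarith)
    simp only [margin_univ] at hgt
    have := hopt _ ⟨u', hu', fun F hF x =>
      (hm' F hF (subset_univ F) x).trans (hm F hF x), rfl⟩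
    omega
  linarith

/-- Linear programming duality is not needed: the gap bound itself certifies that `v` is optimal. A
better real table would beat `u` by more than `g` and so yield an integral table better than `u`. -/
theorem GapAtMost.isGreatest [∀ j, NeZero (d j)] {𝓕 : Finset (Finset (Fin n))} {g : ℝ}
    (hg : GapAtMost d univ (lowerClosure (𝓕 : Set (Finset (Fin n)))) g)
    (u : Cell d → ℤ) (v : Cell d → ℝ) (hu : ∀ x, 0 ≤ u x) (hv : ∀ x, 0 ≤ v x)
    (huv : ∀ F ∈ lowerClosure (𝓕 : Set (Finset (Fin n))), ∀ x,
      margin F v x = ((margin F u x : ℤ) : ℝ))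
    (hopt : ∀ u' : Cell d → ℤ, (∀ x, 0 ≤ u' x) →
      (∀ F ∈ lowerClosure (𝓕 : Set (Finset (Fin n))), ∀ x, margin F u' x = margin F u x) →
      u' (fun _ => 0) ≤ u (fun _ => 0))
    (h0 : v (fun _ => 0) = u (fun _ => 0) + g) :
    IsGreatest (gapSet (modelMatrix d 𝓕) (maxFirstCellCost d)) g := by
  refine ⟨?_, fun δ hδ => hg.le_of_mem_gapSet hδ⟩
  have hip : IsLeast (ipValues (modelMatrix d 𝓕) (maxFirstCellCost d)
      (fun r => ∑ j, modelMatrix d 𝓕 r j * u j)) (-(u (fun _ => 0) : ℝ)) := by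
    refine ⟨(mem_ipValues_iff 𝓕 u _).2 ⟨u, hu, fun _ _ _ => rfl, rfl⟩, ?_⟩
    intro t ht
    obtain ⟨u', hu', hm', rfl⟩ := (mem_ipValues_iff 𝓕 u _).1 ht
    exact neg_le_neg (by exact_mod_cast hopt u' hu' hm')
  have hlp : IsLeast (lpValues (modelMatrix d 𝓕) (maxFirstCellCost d)
      (fun r => ∑ j, modelMatrix d 𝓕 r j * u j)) (-v (fun _ => 0)) := by
    refine ⟨(mem_lpValues_iff 𝓕 u _).2 ⟨v, hv, huv, rfl⟩, ?_⟩
    intro t ht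
    obtain ⟨v', hv', hvm', rfl⟩ := (mem_lpValues_iff 𝓕 u _).1 ht
    by_contra! hlt
    obtain ⟨u', hu', hm', hgt⟩ := hg u v' hu hv' (fun F hF _ x => hvm' F hF x)
      (by simp only [margin_univ]; linarith)
    simp only [margin_univ] at hgt
    have := hopt u' hu' fun F hF x => hm' F hF (subset_univ F) x
    omega
  exact ⟨_, ⟨_, hip.1⟩, ⟨_, hip.2⟩, by rw [hip.csInf_eq, hlp.csInf_eq, h0]; ring⟩

/-- If the gap is at most `0`, then it is attained by the zero table. -/
theorem GapAtMost.isGreatest_zero [∀ j, NeZero (d j)] {𝓕 : Finset (Finset (Fin n))}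
    (hg : GapAtMost d univ (lowerClosure (𝓕 : Set (Finset (Fin n)))) 0) (h𝓕 : 𝓕.Nonempty) :
    IsGreatest (gapSet (modelMatrix d 𝓕) (maxFirstCellCost d)) 0 := by
  obtain ⟨F, hF⟩ := h𝓕
  refine hg.isGreatest 0 0 (by simp) (by simp) (by simp [margin]) ?_ (by simp)
  intro u' hu' hm'
  -- The first entry is at most the corresponding entry of any marginal, which is zero here; this is
  -- where some `F` must exist.
  have h1 := hm' F (subset_lowerClosure hF) (fun _ => 0)
  have h2 := margin_anti (subset_univ F) hu' (fun _ => 0)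
  rw [h1, margin_univ] at h2
  simpa [margin] using h2

end Gap

/-! ### Gluing complexes of gap zero -/

section Glue

variable {n : ℕ} {d : Fin n → ℕ}

theorem margin_single (F : Finset (Fin n)) (x a : Cell d) :
    margin F (Pi.single x (1 : ℤ)) a = if ∀ j ∈ F, x j = a j then 1 else 0 := by
  simp [margin, Finset.sum_pi_single']

theorem exists_pos_of_margin_pos {F : Finset (Fin n)} {u : Cell d → ℤ} {a : Cell d}
    (h : 0 < margin F u a) : ∃ x, 0 < u x ∧ ∀ j ∈ F, x j = a j := by
  by_contra! hc
  refine absurd h (not_lt.2 (Finset.sum_nonpos fun x hx => ?_))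
  by_contra! hux
  obtain ⟨j, hj, hne⟩ := hc x hux
  exact hne ((mem_filter.1 hx).2 j hj)

theorem margin_pos {F : Finset (Fin n)} {u : Cell d → ℤ} (hu : ∀ x, 0 ≤ u x) {a : Cell d}
    (h : 0 < u a) : 0 < margin F u a :=
  h.trans_le (Finset.single_le_sum (f := u) (fun x _ => hu x) (by simp))

/-- Two nonnegative integral tables with the same `V₁ ∩ V₂`-marginal have a common refinement,
whose first entry can be chosen as large as possible. -/
theorem exists_margin_eq_margin_eq [∀ j, NeZero (d j)] (V₁ V₂ : Finset (Fin n)) (N : ℕ) :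
    ∀ u₁ u₂ : Cell d → ℤ, (∀ x, 0 ≤ u₁ x) → (∀ x, 0 ≤ u₂ x) →
      (∀ x, margin (V₁ ∩ V₂) u₁ x = margin (V₁ ∩ V₂) u₂ x) → ∑ x, u₁ x = N →
      ∃ u : Cell d → ℤ, (∀ x, 0 ≤ u x) ∧ (∀ x, margin V₁ u x = margin V₁ u₁ x) ∧
        (∀ x, margin V₂ u x = margin V₂ u₂ x) ∧
        min (margin V₁ u₁ (fun _ => 0)) (margin V₂ u₂ (fun _ => 0)) ≤
          margin (V₁ ∪ V₂) u (fun _ => 0) := by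
  induction N with
  | zero =>
    intro u₁ u₂ h₁ h₂ hm hN
    have e₁ : ∀ x, u₁ x = 0 := by
      simpa [Finset.sum_eq_zero_iff_of_nonneg, h₁] using hN
    have e₂ : ∀ x, u₂ x = 0 := by
      have := margin_eq_of_subset (empty_subset _) hm (fun _ => 0)
      simpa [margin, e₁, Finset.sum_eq_zero_iff_of_nonneg, h₂, eq_comm (a := (0 : ℤ))] using this
    exact ⟨0, by simp, by simp [margin, e₁], by simp [margin, e₂], by simp [margin, e₁, e₂]⟩
  | succ N ih =>
    intro u₁ u₂ h₁ h₂ hm hN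
    -- One unit is removed from each table, at cells agreeing on `V₁ ∩ V₂`. Cells that vanish on
    -- `V₁` and on `V₂` are matched with each other as long as both tables have them, which produces
    -- the minimum in the claim.
    obtain ⟨x, y, hx, hy, hxy, hmin⟩ : ∃ x y, 0 < u₁ x ∧ 0 < u₂ y ∧
        (∀ j ∈ V₁ ∩ V₂, y j = x j) ∧
        (((∀ j ∈ V₁, x j = 0) ∧ (∀ j ∈ V₂, y j = 0)) ∨
          min (margin V₁ u₁ (fun _ => 0)) (margin V₂ u₂ (fun _ => 0)) ≤ 0) := by
      by_cases hc : 0 < min (margin V₁ u₁ (fun _ => 0)) (margin V₂ u₂ (fun _ => 0))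
      · obtain ⟨c₁, c₂⟩ := lt_min_iff.1 hc
        obtain ⟨x, hx, hx0⟩ := exists_pos_of_margin_pos c₁
        obtain ⟨y, hy, hy0⟩ := exists_pos_of_margin_pos c₂
        refine ⟨x, y, hx, hy, fun j hj => ?_, Or.inl ⟨hx0, hy0⟩⟩
        rw [hx0 j (mem_inter.1 hj).1, hy0 j (mem_inter.1 hj).2]
      · obtain ⟨x, -, hx⟩ : ∃ x ∈ univ, 0 < u₁ x :=
          Finset.exists_lt_of_sum_lt (f := fun _ => 0) (by simp [hN])
        have := margin_pos (F := V₁ ∩ V₂) h₁ hx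
        rw [hm] at this
        obtain ⟨y, hy, hxy⟩ := exists_pos_of_margin_pos this
        exact ⟨x, y, hx, hy, hxy, Or.inr (not_lt.1 hc)⟩
    have single_le : ∀ (w : Cell d → ℤ) (a : Cell d), (∀ x, 0 ≤ w x) → 0 < w a →
        ∀ x, 0 ≤ w x - (Pi.single a (1 : ℤ) : Cell d → ℤ) x := by
      intro w a hw ha b
      rcases eq_or_ne b a with rfl | hb
      · simp; omega
      · simpa [hb] using hw b
    obtain ⟨u, hu, hu₁, hu₂, hmu⟩ := ih (fun a => u₁ a - (Pi.single x (1 : ℤ) : Cell d → ℤ) a)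
      (fun a => u₂ a - (Pi.single y (1 : ℤ) : Cell d → ℤ) a)
      (single_le u₁ x h₁ hx) (single_le u₂ y h₂ hy)
      (fun a => by
        rw [margin_sub, margin_sub, hm, margin_single, margin_single]
        have : (∀ j ∈ V₁ ∩ V₂, x j = a j) ↔ ∀ j ∈ V₁ ∩ V₂, y j = a j :=
          forall₂_congr fun j hj => by rw [hxy j hj]
        simp only [this])
      (by simp [Finset.sum_sub_distrib, hN])
    let z : Cell d := fun j => if j ∈ V₁ then x j else y j
    have hz₁ : ∀ j ∈ V₁, z j = x j := fun j hj => by simp [z, hj]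
    have hz₂ : ∀ j ∈ V₂, z j = y j := fun j hj => by
      by_cases hj' : j ∈ V₁
      · simp [z, hj', hxy j (mem_inter.2 ⟨hj', hj⟩)]
      · simp [z, hj']
    simp only [margin_sub, margin_single] at hu₁ hu₂ hmu
    refine ⟨fun a => u a + (Pi.single z (1 : ℤ) : Cell d → ℤ) a, fun a => ?_, fun a => ?_,
      fun a => ?_, ?_⟩
    · have : (0 : ℤ) ≤ (Pi.single z (1 : ℤ) : Cell d → ℤ) a := by
        rw [Pi.single_apply]; split_ifs <;> simp
      exact add_nonneg (hu a) this
    · have : (∀ j ∈ V₁, z j = a j) ↔ ∀ j ∈ V₁, x j = a j :=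
        forall₂_congr fun j hj => by rw [hz₁ j hj]
      rw [margin_add, hu₁, margin_single]
      simp only [this]
      ring
    · have : (∀ j ∈ V₂, z j = a j) ↔ ∀ j ∈ V₂, y j = a j :=
        forall₂_congr fun j hj => by rw [hz₂ j hj]
      rw [margin_add, hu₂, margin_single]
      simp only [this]
      ring
    · rw [margin_add, margin_single]
      rcases hmin with ⟨hx0, hy0⟩ | hmin
      · rw [if_pos hx0, if_pos hy0, min_sub_sub_right] at hmu
        rw [if_pos fun j hj => ?_]
        · linarith
        · rcases mem_union.1 hj with hj | hj
          · rw [hz₁ j hj, hx0 j hj]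
          · rw [hz₂ j hj, hy0 j hj]
      · have := margin_nonneg (V₁ ∪ V₂) hu (fun _ => 0)
        split_ifs <;> omega

/-- Complexes with gap zero can be glued along a common face. -/
theorem GapAtMost.union [∀ j, NeZero (d j)] {V₁ V₂ : Finset (Fin n)} {Δ : Set (Finset (Fin n))}
    (g₁ : GapAtMost d V₁ Δ 0) (g₂ : GapAtMost d V₂ Δ 0) (hS : V₁ ∩ V₂ ∈ Δ)
    (hΔ : ∀ F ∈ Δ, F ⊆ V₁ ∪ V₂ → F ⊆ V₁ ∨ F ⊆ V₂) : GapAtMost d (V₁ ∪ V₂) Δ 0 := by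
  intro u v hu hv huv hlt
  -- Each side needs an integral table whose `W`-entry exceeds the `V₁ ∪ V₂`-entry of `u`. If `v`
  -- does not beat `u` on `W`, then `u` itself serves, because its `W`-entry is at least that of
  -- `v`, hence at least the finer entry of `v`.
  have improve : ∀ W, W ⊆ V₁ ∪ V₂ → GapAtMost d W Δ 0 → ∃ u' : Cell d → ℤ, (∀ x, 0 ≤ u' x) ∧
      (∀ F ∈ Δ, F ⊆ W → ∀ x, margin F u' x = margin F u x) ∧
      margin (V₁ ∪ V₂) u (fun _ => 0) < margin W u' (fun _ => 0) := by
    intro W hW hg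
    by_cases hc : ((margin W u (fun _ => 0) : ℤ) : ℝ) + 0 < margin W v (fun _ => 0)
    · obtain ⟨u', hu', hm, hlt'⟩ := hg u v hu hv (fun F hF hFW => huv F hF (hFW.trans hW)) hc
      exact ⟨u', hu', hm, (margin_anti hW hu _).trans_lt hlt'⟩
    · refine ⟨u, hu, fun _ _ _ _ => rfl, ?_⟩
      have := margin_anti hW hv (fun _ => 0)
      have h : ((margin (V₁ ∪ V₂) u (fun _ => 0) : ℤ) : ℝ) <
          ((margin W u (fun _ => 0) : ℤ) : ℝ) := by linarith
      exact_mod_cast h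
  obtain ⟨u₁, hu₁, hm₁, hlt₁⟩ := improve V₁ subset_union_left g₁
  obtain ⟨u₂, hu₂, hm₂, hlt₂⟩ := improve V₂ subset_union_right g₂
  obtain ⟨u', hu', h₁, h₂, hmin⟩ := exists_margin_eq_margin_eq V₁ V₂ (∑ x, u₁ x).toNat u₁ u₂ hu₁ hu₂
    (fun x => by rw [hm₁ _ hS inter_subset_left, hm₂ _ hS inter_subset_right])
    (Int.toNat_of_nonneg (Finset.sum_nonneg fun x _ => hu₁ x)).symm
  refine ⟨u', hu', fun F hF hFV x => ?_, (lt_min hlt₁ hlt₂).trans_le hmin⟩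
  rcases hΔ F hF hFV with h | h
  · rw [margin_eq_of_subset h h₁, hm₁ F hF h]
  · rw [margin_eq_of_subset h h₂, hm₂ F hF h]

theorem gapAtMost_zero_of_mem [∀ j, NeZero (d j)] {V : Finset (Fin n)}
    {Δ : Set (Finset (Fin n))} (hV : V ∈ Δ) : GapAtMost d V Δ 0 := by
  intro u v _ _ huv hlt
  rw [huv V hV subset_rfl] at hlt
  simp at hlt

/-- If `{i}` is not a face, at most the total is fixed, and then all mass can be moved to the first
cell. If not even `∅` is in `Δ`, nothing is fixed and a unit can be added. -/
theorem gapAtMost_zero_singleton [∀ j, NeZero (d j)] {i : Fin n}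
    {Δ : Set (Finset (Fin n))} : GapAtMost d {i} Δ 0 := by
  by_cases hi : {i} ∈ Δ
  · exact gapAtMost_zero_of_mem hi
  intro u v hu hv huv hlt
  by_cases h0 : ∅ ∈ Δ
  · refine ⟨Pi.single (fun _ => 0) (margin ∅ u (fun _ => 0)), fun x => ?_, ?_, ?_⟩
    · rw [Pi.single_apply]
      split_ifs
      · exact margin_nonneg ∅ hu _
      · rfl
    · intro F hF hFi x
      rcases subset_singleton_iff.1 hFi with rfl | rfl
      · simp [margin]
      · exact absurd hF hi
    · have h₁ := huv ∅ h0 (empty_subset _) (fun _ => 0)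
      have h₂ := margin_anti (empty_subset {i}) hv (fun _ => 0)
      rw [h₁] at h₂
      have h₃ : ((margin {i} u (fun _ => 0) : ℤ) : ℝ) < ((margin ∅ u (fun _ => 0) : ℤ) : ℝ) := by
        linarith
      simpa [margin, Finset.sum_pi_single, Finset.sum_pi_single'] using (Int.cast_lt.1 h₃)
  · refine ⟨fun x => u x + (Pi.single (fun _ => 0) (1 : ℤ) : Cell d → ℤ) x, fun x => ?_,
      fun F hF hFi x => ?_, ?_⟩
    · have : (0 : ℤ) ≤ (Pi.single (fun _ => 0) (1 : ℤ) : Cell d → ℤ) x := by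
        rw [Pi.single_apply]; split_ifs <;> simp
      exact add_nonneg (hu x) this
    · rcases subset_singleton_iff.1 hFi with rfl | rfl
      · exact absurd hF h0
      · exact absurd hF hi
    · rw [margin_add, margin_single]; simp

end Glue

/-! ### Symmetry under permuting the factors -/

section Relabel

theorem margin_relabel {R : Type*} [AddCommMonoid R] (σ : Equiv.Perm (Fin 4))
    (F : Finset (Fin 4)) (u : Cell twoTwoTwoTwo → R) (x : Cell twoTwoTwoTwo) :
    margin F (fun y => u (fun j => y (σ j))) x =
      margin (F.map σ.symm.toEmbedding) u (fun j => x (σ j)) := by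
  unfold margin
  refine Finset.sum_equiv (Equiv.arrowCongr σ.symm (Equiv.refl (Fin 2))) (fun y => ?_)
    fun y _ => rfl
  simp only [mem_filter, mem_univ, true_and, mem_map_equiv, Equiv.symm_symm]
  exact ⟨fun h j hj => h _ hj, fun h j hj => by
    obtain ⟨i, rfl⟩ := σ.surjective j
    exact h i hj⟩

/-- The gap bound is invariant under permutations of the four factors. -/
theorem GapAtMost.relabel (σ : Equiv.Perm (Fin 4)) {V : Finset (Fin 4)}
    {Δ : Set (Finset (Fin 4))} {g : ℝ}
    (h : GapAtMost twoTwoTwoTwo V {F | F.map σ.toEmbedding ∈ Δ} g) :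
    GapAtMost twoTwoTwoTwo (V.map σ.toEmbedding) Δ g := by
  intro u v hu hv huv hlt
  have hm : ∀ {R : Type} [AddCommMonoid R] (F : Finset (Fin 4)) (w : Cell twoTwoTwoTwo → R)
      (x : Cell twoTwoTwoTwo), margin F (fun y => w (fun j => y (σ.symm j))) x =
        margin (F.map σ.toEmbedding) w (fun j => x (σ.symm j)) :=
    fun F w x => margin_relabel σ.symm F w x
  obtain ⟨u', hu', hm', hlt'⟩ := h (fun y => u fun j => y (σ.symm j))
    (fun y => v fun j => y (σ.symm j)) (fun x => hu _) (fun x => hv _)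
    (fun F hF hFV x => by
      rw [hm, hm]
      exact huv _ hF (map_subset_map.2 hFV) _)
    (by rw [hm, hm]; exact hlt)
  have hback : ∀ F : Finset (Fin 4),
      (F.map σ.symm.toEmbedding).map σ.toEmbedding = F := fun F => by
    ext; simp
  refine ⟨fun y => u' fun j => y (σ j), fun x => hu' _, fun F hF hFV x => ?_, ?_⟩
  · have h1 := hm' (F.map σ.symm.toEmbedding) (by simpa [hback] using hF)
      (by rw [← map_subset_map (f := σ.toEmbedding), hback]; exact hFV) (fun j => x (σ j))
    rw [margin_relabel, h1, hm, hback]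
    have hx : ∀ a b : Fin 4, a = b → (x a : Fin 2) = x b := by rintro a _ rfl; rfl
    exact congrArg (margin F u) (funext fun j => hx _ _ (σ.apply_symm_apply j))
  · rw [margin_relabel]
    have : (V.map σ.toEmbedding).map σ.symm.toEmbedding = V := by ext; simp
    rw [this]
    rw [hm] at hlt'
    exact hlt'

theorem exists_perm_fin_four {i j k l : Fin 4} (hij : i ≠ j) (hik : i ≠ k) (hil : i ≠ l)
    (hjk : j ≠ k) (hjl : j ≠ l) (hkl : k ≠ l) :
    ∃ σ : Equiv.Perm (Fin 4), σ 0 = i ∧ σ 1 = j ∧ σ 2 = k ∧ σ 3 = l := by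
  have hinj : Function.Injective ![i, j, k, l] := by
    intro a b
    fin_cases a <;> fin_cases b <;> simp_all [eq_comm]
  exact ⟨Equiv.ofBijective _ (Finite.injective_iff_bijective.1 hinj), rfl, rfl, rfl, rfl⟩

end Relabel

/-! ### Explicit marginals of binary four-way tables -/

section Expand

variable {R : Type*} [AddCommMonoid R]

theorem sum_cell (f : Cell twoTwoTwoTwo → R) :
    ∑ x, f x = ∑ a : Fin 2, ∑ b : Fin 2, ∑ c : Fin 2, ∑ e : Fin 2, f ![a, b, c, e] := by
  rw [← (Fin.consEquiv (fun _ => Fin 2)).sum_comp, Fintype.sum_prod_type]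
  refine Finset.sum_congr rfl fun a _ => ?_
  rw [← (Fin.consEquiv (fun _ => Fin 2)).sum_comp, Fintype.sum_prod_type]
  refine Finset.sum_congr rfl fun b _ => ?_
  rw [← (Fin.consEquiv (fun _ => Fin 2)).sum_comp, Fintype.sum_prod_type]
  refine Finset.sum_congr rfl fun c _ => ?_
  rw [← (Fin.consEquiv (fun _ => Fin 2)).sum_comp, Fintype.sum_prod_type]
  refine Finset.sum_congr rfl fun e _ => ?_
  rw [Fintype.sum_unique]
  rfl

theorem eq_vec (x : Cell twoTwoTwoTwo) : x = ![x 0, x 1, x 2, x 3] := by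
  funext j; fin_cases j <;> rfl

theorem margin_pair01 (u : Cell twoTwoTwoTwo → R) (a b c e : Fin 2) :
    margin {0, 1} u ![a, b, c, e] = ∑ c' : Fin 2, ∑ e' : Fin 2, u ![a, b, c', e'] := by
  simp only [margin, sum_filter, sum_cell]
  simp [ite_and, -Fin.sum_univ_two]

theorem margin_pair02 (u : Cell twoTwoTwoTwo → R) (a b c e : Fin 2) :
    margin {0, 2} u ![a, b, c, e] = ∑ b' : Fin 2, ∑ e' : Fin 2, u ![a, b', c, e'] := by
  simp only [margin, sum_filter, sum_cell]
  simp [ite_and, -Fin.sum_univ_two]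

theorem margin_pair03 (u : Cell twoTwoTwoTwo → R) (a b c e : Fin 2) :
    margin {0, 3} u ![a, b, c, e] = ∑ b' : Fin 2, ∑ c' : Fin 2, u ![a, b', c', e] := by
  simp only [margin, sum_filter, sum_cell]
  simp [ite_and, -Fin.sum_univ_two]

theorem margin_pair12 (u : Cell twoTwoTwoTwo → R) (a b c e : Fin 2) :
    margin {1, 2} u ![a, b, c, e] = ∑ a' : Fin 2, ∑ e' : Fin 2, u ![a', b, c, e'] := by
  simp only [margin, sum_filter, sum_cell]
  simp [ite_and, -Fin.sum_univ_two]

theorem margin_pair13 (u : Cell twoTwoTwoTwo → R) (a b c e : Fin 2) :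
    margin {1, 3} u ![a, b, c, e] = ∑ a' : Fin 2, ∑ c' : Fin 2, u ![a', b, c', e] := by
  simp only [margin, sum_filter, sum_cell]
  simp [ite_and, -Fin.sum_univ_two]

theorem margin_pair23 (u : Cell twoTwoTwoTwo → R) (a b c e : Fin 2) :
    margin {2, 3} u ![a, b, c, e] = ∑ a' : Fin 2, ∑ b' : Fin 2, u ![a', b', c, e] := by
  simp only [margin, sum_filter, sum_cell]
  simp [ite_and, -Fin.sum_univ_two]

theorem margin_triple012 (u : Cell twoTwoTwoTwo → R) (a b c e : Fin 2) :
    margin {0, 1, 2} u ![a, b, c, e] = ∑ e' : Fin 2, u ![a, b, c, e'] := by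
  simp only [margin, sum_filter, sum_cell]
  simp [ite_and, -Fin.sum_univ_two]

theorem margin_triple013 (u : Cell twoTwoTwoTwo → R) (a b c e : Fin 2) :
    margin {0, 1, 3} u ![a, b, c, e] = ∑ c' : Fin 2, u ![a, b, c', e] := by
  simp only [margin, sum_filter, sum_cell]
  simp [ite_and, -Fin.sum_univ_two]

theorem margin_triple023 (u : Cell twoTwoTwoTwo → R) (a b c e : Fin 2) :
    margin {0, 2, 3} u ![a, b, c, e] = ∑ b' : Fin 2, u ![a, b', c, e] := by
  simp only [margin, sum_filter, sum_cell]
  simp [ite_and, -Fin.sum_univ_two]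

theorem margin_triple123 (u : Cell twoTwoTwoTwo → R) (a b c e : Fin 2) :
    margin {1, 2, 3} u ![a, b, c, e] = ∑ a' : Fin 2, u ![a', b, c, e] := by
  simp only [margin, sum_filter, sum_cell]
  simp [ite_and, -Fin.sum_univ_two]

end Expand

/-- It suffices to improve an integral table by a move whose negative entries are controlled by the
difference of the two tables. -/
theorem gapAtMost_univ_of_exists_move {Δ : Set (Finset (Fin 4))} {g : ℝ}
    (h : ∀ w : Cell twoTwoTwoTwo → ℝ, (∀ F ∈ Δ, ∀ x, margin F w x = 0) →
      g < w (fun _ => 0) → ∃ z : Cell twoTwoTwoTwo → ℤ, (∀ F ∈ Δ, ∀ x, margin F z x = 0) ∧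
        0 < z (fun _ => 0) ∧ ∀ x, 0 ≤ z x ∨ w x - 1 < z x) :
    GapAtMost twoTwoTwoTwo univ Δ g := by
  intro u v hu hv huv hlt
  simp only [margin_univ] at hlt ⊢
  obtain ⟨z, hz, hz0, hzw⟩ := h (fun x => v x - u x)
    (fun F hF x => by rw [margin_sub, huv F hF (subset_univ F), margin_intCast, sub_self])
    (by linarith)
  refine ⟨fun x => u x + z x, fun x => ?_, fun F hF _ x => by rw [margin_add, hz F hF, add_zero],
    by linarith⟩
  rcases hzw x with h0 | h0
  · exact add_nonneg (hu x) h0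
  -- Here `u + z > u + w - 1 = v - 1 ≥ -1`, and `u + z` is an integer.
  · have h1 : (-1 : ℝ) < ((u x + z x : ℤ) : ℝ) := by push_cast; linarith [hv x]
    have : (-1 : ℤ) < u x + z x := by exact_mod_cast h1
    show 0 ≤ u x + z x
    omega

/-! ### The 4-cycle and the boundary of a triangle -/

section SmallComplexes

variable {Δ : Set (Finset (Fin 4))}

/-- Up to signs, a table in the kernel is a difference `f c e - g a b`. Replacing `f` and `g` by the
indicators of their positivity gives entries in `{-1, 0, 1}`, and an entry `-1` occurs only where
`W` is negative. -/
theorem four_cycle_move (W : Fin 2 → Fin 2 → Fin 2 → Fin 2 → ℝ)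
    (h02 : ∀ a c, ∑ b, ∑ e, W a b c e = 0) (h03 : ∀ a e, ∑ b, ∑ c, W a b c e = 0)
    (h12 : ∀ b c, ∑ a, ∑ e, W a b c e = 0) (h13 : ∀ b e, ∑ a, ∑ c, W a b c e = 0)
    (h0 : 0 < W 0 0 0 0) :
    ∃ Z : Fin 2 → Fin 2 → Fin 2 → Fin 2 → ℤ,
      (∀ a c, ∑ b, ∑ e, Z a b c e = 0) ∧ (∀ a e, ∑ b, ∑ c, Z a b c e = 0) ∧
      (∀ b c, ∑ a, ∑ e, Z a b c e = 0) ∧ (∀ b e, ∑ a, ∑ c, Z a b c e = 0) ∧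
      0 < Z 0 0 0 0 ∧ ∀ a b c e, 0 ≤ Z a b c e ∨ W a b c e - 1 < Z a b c e := by
  simp only [Fin.forall_fin_two, Fin.sum_univ_two] at h02 h03 h12 h13
  obtain ⟨sg, hsg⟩ : ∃ sg : Fin 2 → Fin 2 → ℤ, sg = fun a b => if a = b then 1 else -1 := ⟨_, rfl⟩
  obtain ⟨f, hf⟩ : ∃ f : Fin 2 → Fin 2 → ℝ, f = fun c e => sg c e * W 0 0 c e := ⟨_, rfl⟩
  -- `f` and `g` are determined up to a common constant, chosen so that `g 0 0 = 0`; hence `f 0 0 =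
  -- W 0 0 0 0 > 0` and the move has first entry `1`.
  obtain ⟨g, hg⟩ : ∃ g : Fin 2 → Fin 2 → ℝ, g = fun a b => W 0 0 0 0 - sg a b * W a b 0 0 :=
    ⟨_, rfl⟩
  have hW : ∀ a b c e, W a b c e = sg a b * sg c e * (f c e - g a b) := by
    intro a b c e
    fin_cases a <;> fin_cases b <;> fin_cases c <;> fin_cases e <;>
      simp [hf, hg, hsg] <;> linarith
  refine ⟨fun a b c e => sg a b * sg c e *
    ((if 0 < f c e then 1 else 0) - (if 0 < g a b then 1 else 0)), ?_, ?_, ?_, ?_, ?_, ?_⟩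
  · intro a c; fin_cases a <;> fin_cases c <;> simp [hsg]
  · intro a c; fin_cases a <;> fin_cases c <;> simp [hsg]
  · intro a c; fin_cases a <;> fin_cases c <;> simp [hsg]
  · intro a c; fin_cases a <;> fin_cases c <;> simp [hsg]
  · simp [hf, hg, hsg, h0]
  · intro a b c e
    rw [hW]
    have : ∀ p q, sg p q = 1 ∨ sg p q = -1 := fun p q => by
      rw [hsg]; by_cases h : p = q <;> simp [h]
    rcases this a b with h1 | h1 <;> rcases this c e with h2 | h2 <;>
      simp only [h1, h2] <;> split_ifs <;> norm_num <;> linarith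

theorem gapAtMost_zero_fourCycle (hΔ : IsLowerSet Δ) (h01 : {0, 1} ∉ Δ) (h23 : {2, 3} ∉ Δ)
    (h02 : {0, 2} ∈ Δ) (h03 : {0, 3} ∈ Δ) (h12 : {1, 2} ∈ Δ) (h13 : {1, 3} ∈ Δ) :
    GapAtMost twoTwoTwoTwo univ Δ 0 := by
  refine gapAtMost_univ_of_exists_move fun w hw hw0 => ?_
  obtain ⟨Z, z02, z03, z12, z13, hz0, hz⟩ := four_cycle_move (fun a b c e => w ![a, b, c, e])
    (fun a c => by simpa only [margin_pair02] using hw _ h02 ![a, 0, c, 0])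
    (fun a e => by simpa only [margin_pair03] using hw _ h03 ![a, 0, 0, e])
    (fun b c => by simpa only [margin_pair12] using hw _ h12 ![0, b, c, 0])
    (fun b e => by simpa only [margin_pair13] using hw _ h13 ![0, b, 0, e])
    (by rwa [eq_vec (fun _ => 0)] at hw0)
  refine ⟨fun x => Z (x 0) (x 1) (x 2) (x 3), fun F hF x => ?_, hz0, fun x => ?_⟩
  -- With both diagonals missing, every face lies in an edge of the cycle.
  · have hF' : ∀ F : Finset (Fin 4), ¬ {0, 1} ⊆ F → ¬ {2, 3} ⊆ F →
        F ⊆ {0, 2} ∨ F ⊆ {0, 3} ∨ F ⊆ {1, 2} ∨ F ⊆ {1, 3} := by decide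
    have key : ∀ G : Finset (Fin 4), F ⊆ G →
        (∀ a b c e, margin G (fun x => Z (x 0) (x 1) (x 2) (x 3)) ![a, b, c, e] = 0) →
        margin F (fun x => Z (x 0) (x 1) (x 2) (x 3)) x = 0 := by
      intro G hFG hG
      rw [margin_eq_of_subset hFG (v := 0) fun y => ?_]
      · simp [margin]
      · rw [eq_vec y, hG]; simp [margin]
    rcases hF' F (fun h => h01 (hΔ h hF)) (fun h => h23 (hΔ h hF)) with h | h | h | h
    · exact key _ h fun a b c e => by rw [margin_pair02]; exact z02 a c
    · exact key _ h fun a b c e => by rw [margin_pair03]; exact z03 a e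
    · exact key _ h fun a b c e => by rw [margin_pair12]; exact z12 b c
    · exact key _ h fun a b c e => by rw [margin_pair13]; exact z13 b e
  · have := hz (x 0) (x 1) (x 2) (x 3)
    rwa [← eq_vec x] at this

/-- For binary three-way tables the pair marginals leave a one-dimensional kernel, spanned by the
parity sign `sg`. So `q - p` is a positive multiple of `sg`, which makes `p` positive wherever `sg =
-1`, and `p + sg` is an admissible improvement. -/
theorem gapAtMost_zero_triangle (hV : {0, 1, 2} ∉ Δ) (h01 : {0, 1} ∈ Δ) (h02 : {0, 2} ∈ Δ)
    (h12 : {1, 2} ∈ Δ) : GapAtMost twoTwoTwoTwo {0, 1, 2} Δ 0 := by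
  intro u v hu hv huv hlt
  have e01 := huv _ h01 (by decide)
  have e02 := huv _ h02 (by decide)
  have e12 := huv _ h12 (by decide)
  obtain ⟨p, hp⟩ : ∃ p : Fin 2 → Fin 2 → Fin 2 → ℤ,
    p = fun a b c => ∑ e, u ![a, b, c, e] := ⟨_, rfl⟩
  obtain ⟨q, hq⟩ : ∃ q : Fin 2 → Fin 2 → Fin 2 → ℝ,
    q = fun a b c => ∑ e, v ![a, b, c, e] := ⟨_, rfl⟩
  have q01 : ∀ a b, ∑ c, q a b c = ((∑ c, p a b c : ℤ) : ℝ) := fun a b => by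
    simpa only [margin_pair01, hp, hq] using e01 ![a, b, 0, 0]
  have q02 : ∀ a c, ∑ b, q a b c = ((∑ b, p a b c : ℤ) : ℝ) := fun a c => by
    simpa only [margin_pair02, hp, hq] using e02 ![a, 0, c, 0]
  have q12 : ∀ b c, ∑ a, q a b c = ((∑ a, p a b c : ℤ) : ℝ) := fun b c => by
    simpa only [margin_pair12, hp, hq] using e12 ![0, b, c, 0]
  have q0 : (p 0 0 0 : ℝ) < q 0 0 0 := by
    rw [eq_vec (fun _ => 0), margin_triple012, margin_triple012] at hlt
    simpa [hp, hq] using hlt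
  have hqn : ∀ a b c, 0 ≤ q a b c := fun a b c => by
    rw [hq]; exact Finset.sum_nonneg fun e _ => hv _
  have hpn : ∀ a b c, 0 ≤ p a b c := fun a b c => by
    rw [hp]; exact Finset.sum_nonneg fun e _ => hu _
  obtain ⟨sg, hsg⟩ : ∃ sg : Fin 2 → Fin 2 → Fin 2 → ℤ,
    sg = fun a b c => (if a = b then 1 else -1) * (if c = 0 then 1 else -1) := ⟨_, rfl⟩
  have hpos : ∀ a b c, 0 ≤ p a b c + sg a b c := by
    have hcast : ∀ a b c, (0 : ℝ) < p a b c → 1 ≤ p a b c := fun a b c h => by exact_mod_cast h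
    simp only [Fin.forall_fin_two, Fin.sum_univ_two] at q01 q02 q12 hqn hpn ⊢
    push_cast at q01 q02 q12
    have h1 : 1 ≤ p 0 0 1 := hcast _ _ _ (by linarith)
    have h2 : 1 ≤ p 0 1 0 := hcast _ _ _ (by linarith)
    have h3 : 1 ≤ p 1 0 0 := hcast _ _ _ (by linarith)
    have h4 : 1 ≤ p 1 1 1 := hcast _ _ _ (by linarith)
    simp only [hsg]
    norm_num
    omega
  -- Only marginals inside `{0, 1, 2}` matter, so the improved three-way table is placed in the
  -- layer `x 3 = 0`.
  refine ⟨fun x => if x 3 = 0 then p (x 0) (x 1) (x 2) + sg (x 0) (x 1) (x 2) else 0,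
    fun x => ?_, fun F hF hFV x => ?_, ?_⟩
  · dsimp only
    split_ifs
    · exact hpos _ _ _
    · exact le_rfl
  · have hF' : ∀ F : Finset (Fin 4), F ⊆ {0, 1, 2} → F ≠ {0, 1, 2} →
        F ⊆ {0, 1} ∨ F ⊆ {0, 2} ∨ F ⊆ {1, 2} := by decide
    rcases hF' F hFV (fun h => hV (h ▸ hF)) with h | h | h
    · refine margin_eq_of_subset h (fun y => ?_) x
      rw [eq_vec y, margin_pair01, margin_pair01]
      simp only [hp, hsg, Fin.sum_univ_two]
      generalize y 0 = a; generalize y 1 = b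
      fin_cases a <;> fin_cases b <;> simp <;> ring
    · refine margin_eq_of_subset h (fun y => ?_) x
      rw [eq_vec y, margin_pair02, margin_pair02]
      simp only [hp, hsg, Fin.sum_univ_two]
      generalize y 0 = a; generalize y 2 = c
      fin_cases a <;> fin_cases c <;> simp <;> ring
    · refine margin_eq_of_subset h (fun y => ?_) x
      rw [eq_vec y, margin_pair12, margin_pair12]
      simp only [hp, hsg, Fin.sum_univ_two]
      generalize y 1 = a; generalize y 2 = c
      fin_cases a <;> fin_cases c <;> simp <;> ring
  · rw [eq_vec (fun _ => 0), margin_triple012, margin_triple012]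
    simp [hp, hsg]

end SmallComplexes

/-! ### Complexes whose graph is not complete -/

section Classification

variable {Δ : Set (Finset (Fin 4))}

/-- Gluing, with the condition on faces expressed by missing edges. -/
theorem GapAtMost.union_of_not_mem {n : ℕ} {d : Fin n → ℕ} [∀ j, NeZero (d j)]
    {V₁ V₂ S W : Finset (Fin n)} {Δ : Set (Finset (Fin n))} (hΔ : IsLowerSet Δ)
    (g₁ : GapAtMost d V₁ Δ 0) (g₂ : GapAtMost d V₂ Δ 0) (hS : S ∈ Δ) (hI : V₁ ∩ V₂ = S)
    (hW : V₁ ∪ V₂ = W) (h : ∀ i ∈ V₁, i ∉ V₂ → ∀ j ∈ V₂, j ∉ V₁ → {i, j} ∉ Δ) :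
    GapAtMost d W Δ 0 := by
  subst hI hW
  refine g₁.union g₂ hS fun F hF hFV => ?_
  by_contra! hc
  obtain ⟨j, hj, hj₁⟩ := not_subset.1 hc.1
  obtain ⟨i, hi, hi₂⟩ := not_subset.1 hc.2
  refine h i ((mem_union.1 (hFV hi)).resolve_right hi₂) hi₂ j
    ((mem_union.1 (hFV hj)).resolve_left hj₁) hj₁ (hΔ ?_ hF)
  simp [insert_subset_iff, hi, hj]

theorem gapAtMost_zero_pair (hΔ : IsLowerSet Δ) (h0 : ∅ ∈ Δ) {i j : Fin 4} (hij : i ≠ j) :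
    GapAtMost twoTwoTwoTwo {i, j} Δ 0 := by
  by_cases h : {i, j} ∈ Δ
  · exact gapAtMost_zero_of_mem h
  · exact GapAtMost.union_of_not_mem (V₁ := {i}) (V₂ := {j}) hΔ gapAtMost_zero_singleton
      gapAtMost_zero_singleton h0 (by simp [hij]) (by ext; simp) (by simpa [hij, hij.symm] using h)

theorem not_pair_mem_of_not_mem {n : ℕ} {Δ : Set (Finset (Fin n))} (hΔ : IsLowerSet Δ)
    {l : Fin n} (hl : {l} ∉ Δ) (m : Fin n) : {l, m} ∉ Δ :=
  fun h => hl (hΔ (by simp) h)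

/-- Without the edge `{i, j}` the complex splits along the vertex `k`. If `k` is not a vertex of
`Δ`, it splits off along the empty face. -/
theorem gapAtMost_zero_triple_of_not_mem (hΔ : IsLowerSet Δ) (h0 : ∅ ∈ Δ) {i j k : Fin 4}
    (hij : i ≠ j) (hik : i ≠ k) (hjk : j ≠ k) (h : {i, j} ∉ Δ) :
    GapAtMost twoTwoTwoTwo {i, j, k} Δ 0 := by
  by_cases hk : {k} ∈ Δ
  · refine GapAtMost.union_of_not_mem (V₁ := {i, k}) (V₂ := {j, k}) hΔ
      (gapAtMost_zero_pair hΔ h0 hik) (gapAtMost_zero_pair hΔ h0 hjk) hk ?_ ?_ ?_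
    · clear h hk; revert i j k; decide
    · clear h hk; revert i j k; decide
    · simp [hij, hik, hjk, hij.symm, h]
  · refine GapAtMost.union_of_not_mem (V₁ := {k}) (V₂ := {i, j}) hΔ
      gapAtMost_zero_singleton (gapAtMost_zero_pair hΔ h0 hij) h0 ?_ ?_ ?_
    · simp [hik.symm, hjk.symm]
    · ext; simp; tauto
    · simp [not_pair_mem_of_not_mem hΔ hk]

theorem gapAtMost_zero_triple (hΔ : IsLowerSet Δ) (h0 : ∅ ∈ Δ) {i j k : Fin 4}
    (hij : i ≠ j) (hik : i ≠ k) (hjk : j ≠ k) : GapAtMost twoTwoTwoTwo {i, j, k} Δ 0 := by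
  by_cases h : {i, j, k} ∈ Δ
  · exact gapAtMost_zero_of_mem h
  by_cases h1 : {i, j} ∈ Δ
  swap
  · exact gapAtMost_zero_triple_of_not_mem hΔ h0 hij hik hjk h1
  by_cases h2 : {i, k} ∈ Δ
  swap
  · rw [show ({i, j, k} : Finset (Fin 4)) = {i, k, j} by ext; simp; tauto]
    exact gapAtMost_zero_triple_of_not_mem hΔ h0 hik hij hjk.symm h2
  by_cases h3 : {j, k} ∈ Δ
  swap
  · rw [show ({i, j, k} : Finset (Fin 4)) = {j, k, i} by ext; simp; tauto]
    exact gapAtMost_zero_triple_of_not_mem hΔ h0 hjk hij.symm hik.symm h3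
  obtain ⟨l, hil, hjl, hkl⟩ : ∃ l, i ≠ l ∧ j ≠ l ∧ k ≠ l := by
    clear h h1 h2 h3; revert i j k; decide
  obtain ⟨σ, rfl, rfl, rfl, rfl⟩ := exists_perm_fin_four hij hik hil hjk hjl hkl
  have := (gapAtMost_zero_triangle (Δ := {F | F.map σ.toEmbedding ∈ Δ}) (by simpa using h)
    (by simpa using h1) (by simpa using h2) (by simpa using h3)).relabel σ
  simpa using this

/-- The only possible neighbour of `i` is `l`, so `{i, l}` is glued to the remaining triple along
`{l}`, or `l` splits off if it lies in no face. -/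
theorem gapAtMost_zero_of_not_mem_of_not_mem (hΔ : IsLowerSet Δ) (h0 : ∅ ∈ Δ) {i j k l : Fin 4}
    (hij : i ≠ j) (hik : i ≠ k) (hil : i ≠ l) (hjk : j ≠ k) (hjl : j ≠ l) (hkl : k ≠ l)
    (h1 : {i, j} ∉ Δ) (h2 : {i, k} ∉ Δ) : GapAtMost twoTwoTwoTwo univ Δ 0 := by
  by_cases hl : {l} ∈ Δ
  · refine GapAtMost.union_of_not_mem (V₁ := {i, l}) (V₂ := {j, k, l}) hΔ
      (gapAtMost_zero_pair hΔ h0 hil) (gapAtMost_zero_triple hΔ h0 hjk hjl hkl) hl ?_ ?_ ?_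
    · clear h1 h2 hl; revert i j k l; decide
    · clear h1 h2 hl; revert i j k l; decide
    · simp [hij, hik, hil, hjl, hkl, h1, h2]
  · refine GapAtMost.union_of_not_mem (V₁ := {l}) (V₂ := {i, j, k}) hΔ
      gapAtMost_zero_singleton (gapAtMost_zero_triple hΔ h0 hij hik hjk) h0 ?_ ?_ ?_
    · simp [hil.symm, hjl.symm, hkl.symm]
    · clear h1 h2 hl; revert i j k l; decide
    · simp [not_pair_mem_of_not_mem hΔ hl]

/-- If the graph of the complex is not complete, then the gap is zero. -/
theorem gapAtMost_zero_of_not_edge (hΔ : IsLowerSet Δ) (h0 : ∅ ∈ Δ) {i j : Fin 4} (hij : i ≠ j)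
    (h : {i, j} ∉ Δ) : GapAtMost twoTwoTwoTwo univ Δ 0 := by
  obtain ⟨k, l, hik, hil, hjk, hjl, hkl⟩ :
      ∃ k l, i ≠ k ∧ i ≠ l ∧ j ≠ k ∧ j ≠ l ∧ k ≠ l := by clear h; revert i j; decide
  have h' : {j, i} ∉ Δ := by rwa [pair_comm]
  -- If `{k, l}` is a face, it separates `i` from `j`. Otherwise two opposite edges are missing: one
  -- further missing edge leaves a vertex with two missing edges, and none leaves the 4-cycle.
  by_cases hk : {k, l} ∈ Δ
  · refine GapAtMost.union_of_not_mem (V₁ := {i, k, l}) (V₂ := {j, k, l}) hΔ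
      (gapAtMost_zero_triple hΔ h0 hik hil hkl) (gapAtMost_zero_triple hΔ h0 hjk hjl hkl) hk ?_ ?_ ?_
    · clear h h' hk; revert i j k l; decide
    · clear h h' hk; revert i j k l; decide
    · simp [hij, hik, hil, hjk, hjl, h]
  by_cases h1 : {i, k} ∈ Δ
  swap
  · exact gapAtMost_zero_of_not_mem_of_not_mem hΔ h0 hij hik hil hjk hjl hkl h h1
  by_cases h2 : {i, l} ∈ Δ
  swap
  · exact gapAtMost_zero_of_not_mem_of_not_mem hΔ h0 hij hil hik hjl hjk hkl.symm h h2
  by_cases h3 : {j, k} ∈ Δ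
  swap
  · exact gapAtMost_zero_of_not_mem_of_not_mem hΔ h0 hij.symm hjk hjl hik hil hkl h' h3
  by_cases h4 : {j, l} ∈ Δ
  swap
  · exact gapAtMost_zero_of_not_mem_of_not_mem hΔ h0 hij.symm hjl hjk hil hik hkl.symm h' h4
  obtain ⟨σ, rfl, rfl, rfl, rfl⟩ := exists_perm_fin_four hij hik hil hjk hjl hkl
  have := (gapAtMost_zero_fourCycle (Δ := {F | F.map σ.toEmbedding ∈ Δ})
    (fun F G hGF hF => hΔ (map_subset_map.2 hGF) hF) (by simpa using h)
    (by simpa using hk) (by simpa using h1) (by simpa using h2) (by simpa using h3)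
    (by simpa using h4)).relabel σ
  simpa using this

end Classification

/-! ### Rounding the five parameters -/

section Arithmetic

/-- The integral move with parameters `c`, `p` on the binary tables whose two-dimensional margins
vanish is available at the real point with parameters `a`, `s`: its negative part is bounded by
that of `a`, `s`, rounded up. The elements of `T` are the parameters which are bound to the first
entry. -/
def MoveAvailable (T : Finset (Fin 5)) (a : Fin 5 → ℝ) (s : ℝ) (c : Fin 5 → ℤ) (p : ℤ) : Prop :=
  ∑ i, c i = 3 * p ∧ 0 < p ∧ (∀ i ∈ T, c i = p) ∧ (∀ i, c i ≤ 0 ∨ (c i : ℝ) < a i + 1) ∧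
    ∀ i j, i ≠ j → p - c i - c j ≤ 0 ∨ (p - c i - c j : ℝ) < s - a i - a j + 1

variable {T : Finset (Fin 5)} {a : Fin 5 → ℝ} {s : ℝ}

/-- Any pair meeting `R` satisfies `p - c i - c j ≤ 0`, so the complement of `R` is the only pair to
check. Its condition `a i + a j < s` is the hypothesis on the sum over `R`, because the total is `3
s`. -/
theorem moveAvailable_indicator {R : Finset (Fin 5)} (hR : R.card = 3) (hTR : T ⊆ R)
    (ha : ∑ i, a i = 3 * s) (hpos : ∀ i ∈ R, 0 < a i) (hsum : 2 * s < ∑ i ∈ R, a i) :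
    MoveAvailable T a s (fun i => if i ∈ R then 1 else 0) 1 := by
  refine ⟨by simp [hR], by norm_num, fun i hi => by simp [hTR hi], fun i => ?_, fun i j hij => ?_⟩
  · by_cases hi : i ∈ R
    · right; simpa [hi] using hpos i hi
    · left; simp [hi]
  · by_cases hi : i ∈ R
    · left; simp only [hi, if_true]; split_ifs <;> norm_num
    by_cases hj : j ∈ R
    · left; simp [hi, hj]
    right
    have hc : ({i, j} : Finset (Fin 5)) = Rᶜ := by
      refine eq_of_subset_of_card_le (by simp [insert_subset_iff, hi, hj]) ?_
      rw [card_compl, hR, card_pair hij]; rfl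
    have := sum_add_sum_compl R a
    rw [← hc, sum_pair hij, ha] at this
    simp only [hi, hj, if_false]
    push_cast
    linarith

theorem MoveAvailable.of_perm (σ : Equiv.Perm (Fin 5)) {c : Fin 5 → ℤ} {p : ℤ}
    (h : MoveAvailable (T.map σ.symm.toEmbedding) (fun i => a (σ i)) s c p) :
    MoveAvailable T a s (fun i => c (σ.symm i)) p := by
  obtain ⟨h1, h2, h3, h4, h5⟩ := h
  refine ⟨by rw [← h1]; exact Equiv.sum_comp σ.symm c, h2, fun i hi => h3 _ (by simpa using hi),
    fun i => by simpa using h4 (σ.symm i), fun i j hij => ?_⟩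
  simpa using h5 (σ.symm i) (σ.symm j) (by simpa using hij)

theorem exists_perm_antitone (a : Fin 5 → ℝ) (t : Fin 5) :
    ∃ σ : Equiv.Perm (Fin 5), σ 0 = t ∧ a (σ 2) ≤ a (σ 1) ∧ a (σ 3) ≤ a (σ 2) ∧
      a (σ 4) ≤ a (σ 3) := by
  obtain ⟨B, hB⟩ : ∃ B, ∀ i, a i < B := by
    refine ⟨∑ i, |a i| + 1, fun i => ?_⟩
    have := single_le_sum (f := fun i => |a i|) (fun i _ => abs_nonneg _) (mem_univ i)
    have := le_abs_self (a i)
    linarith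
  -- Sorting by `-a` with the key of `t` lowered below all others puts `t` first and the rest in
  -- decreasing order.
  obtain ⟨f, hft, hf⟩ : ∃ f : Fin 5 → ℝ, f t = -B ∧ ∀ i, i ≠ t → f i = -a i :=
    ⟨fun i => if i = t then -B else -a i, by simp, fun i hi => by simp [hi]⟩
  obtain ⟨σ, hm⟩ : ∃ σ : Equiv.Perm (Fin 5), ∀ i j, i ≤ j → f (σ i) ≤ f (σ j) :=
    ⟨Tuple.sort f, fun _ _ h => Tuple.monotone_sort f h⟩
  have h0 : σ 0 = t := by
    by_contra hne
    have := hm _ _ (Fin.zero_le (σ.symm t))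
    rw [Equiv.apply_symm_apply, hft, hf _ hne] at this
    linarith [hB (σ 0)]
  have hle : ∀ i j : Fin 5, i ≠ 0 → j ≠ 0 → i ≤ j → a (σ j) ≤ a (σ i) := by
    intro i j hi hj hij
    have := hm i j hij
    rw [hf _ (fun h => hi (σ.injective (h.trans h0.symm))),
      hf _ (fun h => hj (σ.injective (h.trans h0.symm)))] at this
    linarith
  exact ⟨σ, h0, hle 1 2 (by decide) (by decide) (by decide),
    hle 2 3 (by decide) (by decide) (by decide), hle 3 4 (by decide) (by decide) (by decide)⟩

theorem moveAvailable_of_explicit {c : Fin 5 → ℤ} {p : ℤ} (hc : ∑ i, c i = 3 * p) (hp : 0 < p)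
    (hT : ∀ i ∈ T, c i = p) (h : ∀ i, c i ≤ 0 ∨ (c i : ℝ) < a i + 1)
    (h' : ∀ i j, i < j → p - c i - c j ≤ 0 ∨ (p - c i - c j : ℝ) < s - a i - a j + 1) :
    MoveAvailable T a s c p := by
  refine ⟨hc, hp, hT, h, fun i j hij => ?_⟩
  rcases lt_or_gt_of_ne hij with hlt | hlt
  · exact h' i j hlt
  · rcases h' j i hlt with h | h
    · left; linarith
    · right; linarith

/-- The move depends on how many parameters are positive. Index `0` carries the bound parameter if
there is one, and the largest parameter otherwise. -/
theorem exists_moveAvailable_of_sorted (hT : T ⊆ {0}) (ha : ∑ i, a i = 3 * s)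
    (haT : ∀ i ∈ T, a i = s) (h0 : T = ∅ → 5 / 3 < s) (h1 : 1 < s)
    (h01 : T = ∅ → a 1 ≤ a 0) (h12 : a 2 ≤ a 1) (h23 : a 3 ≤ a 2) (h34 : a 4 ≤ a 3) :
    ∃ c p, MoveAvailable T a s c p := by
  have ha' : a 0 + a 1 + a 2 + a 3 + a 4 = 3 * s := by rw [← ha, Fin.sum_univ_five]
  rcases subset_singleton_iff.1 hT with rfl | rfl
  · have h01 := h01 rfl
    have h0 := h0 rfl
    by_cases c2 : 0 < a 2
    · by_cases c34 : a 3 + a 4 < s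
      · refine ⟨_, _, moveAvailable_indicator (R := {0, 1, 2}) rfl (by simp) ha ?_ ?_⟩
        · simp only [mem_insert, mem_singleton, forall_eq_or_imp, forall_eq]
          exact ⟨by linarith, by linarith, c2⟩
        · simp
          linarith
      -- All pair conditions hold trivially. What is needed is `a 0 > 1`, which follows from `5 * a
      -- 0 ≥ 3 * s > 5`, and `a 4 > 0`: since `a 3 + a 4 ≥ s`, the first three parameters sum to at
      -- most `2 s`, so `a 3 ≤ 2 s / 3`.
      · refine ⟨![2, 1, 1, 1, 1], 2, moveAvailable_of_explicit (by simp [Fin.sum_univ_five])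
          (by norm_num) (by simp) ?_ ?_⟩
        · simp [Fin.forall_fin_succ]
          and_intros <;> linarith
        · intro i j hij
          left
          fin_cases i <;> fin_cases j <;> simp_all
    · by_cases c1 : 0 < a 1
      · refine ⟨![2, 1, 0, 0, 0], 1, moveAvailable_of_explicit (by simp [Fin.sum_univ_five])
          (by norm_num) (by simp) ?_ ?_⟩
        · simp [Fin.forall_fin_succ]
          and_intros <;> linarith
        · simp [Fin.forall_fin_succ]
          and_intros <;> linarith
      · refine ⟨![3, 0, 0, 0, 0], 1, moveAvailable_of_explicit (by simp [Fin.sum_univ_five])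
          (by norm_num) (by simp) ?_ ?_⟩
        · simp [Fin.forall_fin_succ]
          linarith
        · simp [Fin.forall_fin_succ]
          and_intros <;> linarith
  · have hs : a 0 = s := haT 0 (by simp)
    by_cases c2 : 0 < a 2
    · by_cases c34 : a 3 + a 4 < s
      · refine ⟨_, _, moveAvailable_indicator (R := {0, 1, 2}) rfl (by simp) ha ?_ ?_⟩
        · simp only [mem_insert, mem_singleton, forall_eq_or_imp, forall_eq]
          exact ⟨by linarith, by linarith, c2⟩
        · simp
          linarith
      -- The condition at index `0` reads `2 < s + 1`, which is why one bound parameter requires `s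
      -- > 1`.
      · refine ⟨![2, 1, 1, 1, 1], 2, moveAvailable_of_explicit (by simp [Fin.sum_univ_five])
          (by norm_num) (by simp) ?_ ?_⟩
        · simp [Fin.forall_fin_succ]
          and_intros <;> linarith
        · intro i j hij
          left
          fin_cases i <;> fin_cases j <;> simp_all
    -- The four free parameters sum to `2 s`, and the last three are nonpositive, so `a 1 ≥ 2 s >
    -- 1`.
    · refine ⟨![1, 2, 0, 0, 0], 1, moveAvailable_of_explicit (by simp [Fin.sum_univ_five])
        (by norm_num) (by simp) ?_ ?_⟩
      · simp [Fin.forall_fin_succ]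
        and_intros <;> linarith
      · simp [Fin.forall_fin_succ]
        and_intros <;> linarith

/-- Some integral move is available as soon as `s` exceeds the gap. -/
theorem exists_moveAvailable (ha : ∑ i, a i = 3 * s) (haT : ∀ i ∈ T, a i = s) (hs : 0 < s)
    (h0 : T = ∅ → 5 / 3 < s) (h1 : T.card = 1 → 1 < s) : ∃ c p, MoveAvailable T a s c p := by
  have sorted : ∀ t, T ⊆ {t} → (T = ∅ → ∀ i, a i ≤ a t) → ∃ c p, MoveAvailable T a s c p := by
    intro t ht hmax
    obtain ⟨σ, rfl, h12, h23, h34⟩ := exists_perm_antitone a t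
    have hT : T = ∅ ∨ T.card = 1 := by
      rcases subset_singleton_iff.1 ht with h | h <;> simp [h]
    obtain ⟨c, p, h⟩ := exists_moveAvailable_of_sorted
      (T := T.map σ.symm.toEmbedding) (a := fun i => a (σ i)) (s := s)
      (fun i hi => by
        have := ht (by simpa using hi : σ i ∈ T)
        simpa using this)
      (by rw [← ha]; exact Equiv.sum_comp σ a) (fun i hi => haT _ (by simpa using hi))
      (fun h => h0 (by simpa using h))
      (by rcases hT with h | h
          · linarith [h0 h]
          · exact h1 h)
      (fun h => hmax (by simpa using h) _) h12 h23 h34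
    exact ⟨_, p, h.of_perm σ⟩
  have hsum := sum_add_sum_compl T a
  rw [sum_congr rfl haT, sum_const, nsmul_eq_mul, ha] at hsum
  have hcard : T.card ≤ 5 := card_le_univ T
  have hcompl : Tᶜ.card = 5 - T.card := card_compl T
  interval_cases hc : T.card
  · obtain ⟨t, -, ht⟩ := exists_max_image univ a ⟨0, mem_univ 0⟩
    exact sorted t (by simp [card_eq_zero.1 hc]) fun _ i => ht i (mem_univ i)
  · obtain ⟨t, rfl⟩ := card_eq_one.1 hc
    exact sorted t subset_rfl (by simp)
  -- Two bound parameters contribute `2 s`, so the other three sum to `s > 0`; any positive one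
  -- completes `R`.
  · obtain ⟨i, hi, hai⟩ : ∃ i ∈ Tᶜ, 0 < a i :=
      exists_lt_of_sum_lt (f := fun _ => 0) (by simp; push_cast at hsum; linarith)
    rw [mem_compl] at hi
    refine ⟨_, _, moveAvailable_indicator (R := insert i T) (by rw [card_insert_of_notMem hi, hc])
      (subset_insert i T) ha ?_ ?_⟩
    · rw [forall_mem_insert]
      exact ⟨hai, fun j hj => by rwa [haT j hj]⟩
    · rw [sum_insert hi, sum_congr rfl haT, sum_const, nsmul_eq_mul, hc]
      push_cast
      linarith
  · refine ⟨_, _, moveAvailable_indicator (R := T) hc subset_rfl ha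
      (fun j hj => by rwa [haT j hj]) ?_⟩
    rw [sum_congr rfl haT, sum_const, nsmul_eq_mul, hc]
    push_cast
    linarith
  -- Four bound parameters force the fifth to be `-s`, and the move has the same shape with `s`
  -- replaced by `1`.
  · obtain ⟨o, ho⟩ := card_eq_one.1 hcompl
    have hmem : ∀ i, i ∈ T ↔ i ≠ o := fun i => by
      rw [← not_iff_not, ← mem_compl, ho]; simp
    rw [ho, sum_singleton] at hsum
    push_cast at hsum
    refine ⟨fun i => if i = o then -1 else 1, 1, ?_, by norm_num, fun i hi => ?_, fun i => ?_,
      fun i j hij => ?_⟩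
    · rw [sum_ite, filter_eq' univ o, filter_ne' univ o]
      simp
    · simp [(hmem i).1 hi]
    · by_cases hi : i = o
      · left; simp [hi]
      · right; simpa [hi, haT i ((hmem i).2 hi)] using hs
    · by_cases hi : i = o
      · subst hi
        right
        simp [hij.symm, haT j ((hmem j).2 hij.symm)]
        linarith
      · by_cases hj : j = o
        · subst hj
          right
          simp [hij, haT i ((hmem i).2 hij)]
          linarith
        · left; simp [hi, hj]
  -- Five bound parameters would give `5 s = 3 s`.
  · rw [card_eq_zero.1 hcompl, sum_empty] at hsum
    push_cast at hsum
    linarith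

end Arithmetic

/-! ### Tables with vanishing pair marginals -/

section CompleteGraph

/-- The tables whose two-dimensional margins vanish: the first entry is `s`, and the parameters `a`
are the negatives of the five entries at the cells `1111` and `1000, 0100, 0010, 0001`. -/
def moveTable {R : Type*} [CommRing R] (s : R) (a : Fin 5 → R) (x : Cell twoTwoTwoTwo) : R :=
  (if x 0 = x 1 then 1 else -1) * (if x 2 = x 3 then 1 else -1) *
    (s - ((if x 0 = 0 then 0 else s - a 1) + (if x 1 = 0 then 0 else s - a 2) +
      (if x 2 = 0 then 0 else s - a 3) + (if x 3 = 0 then 0 else s - a 4)))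

/-- This exposes the symmetry in all five parameters. The indices `i`, `j` are chosen before the
ring, so the same description applies to the real difference and to the integral move. -/
theorem moveTable_cases (x : Cell twoTwoTwoTwo) :
    x = (fun _ => 0) ∨
    (∃ i, ∀ (R : Type) [CommRing R] (s : R) (a : Fin 5 → R), ∑ i, a i = 3 * s →
      moveTable s a x = -a i) ∨
    ∃ i j, i ≠ j ∧ ∀ (R : Type) [CommRing R] (s : R) (a : Fin 5 → R), ∑ i, a i = 3 * s →
      moveTable s a x = a i + a j - s := by
  have single : ∀ (y : Cell twoTwoTwoTwo) (i : Fin 5),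
      (∀ (R : Type) [CommRing R] (s : R) (a : Fin 5 → R), a 0 + a 1 + a 2 + a 3 + a 4 = 3 * s →
        moveTable s a y = -a i) →
      ∃ i, ∀ (R : Type) [CommRing R] (s : R) (a : Fin 5 → R), ∑ i, a i = 3 * s →
        moveTable s a y = -a i :=
    fun y i h => ⟨i, fun R _ s a ha => h R s a (by rw [← ha, Fin.sum_univ_five])⟩
  have pair : ∀ (y : Cell twoTwoTwoTwo) (i j : Fin 5), i ≠ j →
      (∀ (R : Type) [CommRing R] (s : R) (a : Fin 5 → R), a 0 + a 1 + a 2 + a 3 + a 4 = 3 * s →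
        moveTable s a y = a i + a j - s) →
      ∃ i j, i ≠ j ∧ ∀ (R : Type) [CommRing R] (s : R) (a : Fin 5 → R), ∑ i, a i = 3 * s →
        moveTable s a y = a i + a j - s :=
    fun y i j hij h => ⟨i, j, hij, fun R _ s a ha => h R s a (by rw [← ha, Fin.sum_univ_five])⟩
  have h : ∀ y : Fin 4 → Fin 2, y = ![0, 0, 0, 0] ∨ y = ![1, 0, 0, 0] ∨ y = ![0, 1, 0, 0] ∨ y = ![0, 0, 1, 0] ∨
      y = ![0, 0, 0, 1] ∨ y = ![1, 1, 1, 1] ∨ y = ![1, 1, 0, 0] ∨ y = ![1, 0, 1, 0] ∨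
      y = ![1, 0, 0, 1] ∨ y = ![0, 1, 1, 0] ∨ y = ![0, 1, 0, 1] ∨ y = ![0, 0, 1, 1] ∨
      y = ![0, 1, 1, 1] ∨ y = ![1, 0, 1, 1] ∨ y = ![1, 1, 0, 1] ∨ y = ![1, 1, 1, 0] := by
    decide
  rcases h x with rfl | rfl | rfl | rfl | rfl | rfl | rfl | rfl | rfl | rfl | rfl | rfl | rfl | rfl |
    rfl | rfl
  · left; decide
  · exact Or.inr (Or.inl (single _ 1 fun R _ s a ha => by simp [moveTable]))
  · exact Or.inr (Or.inl (single _ 2 fun R _ s a ha => by simp [moveTable]))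
  · exact Or.inr (Or.inl (single _ 3 fun R _ s a ha => by simp [moveTable]))
  · exact Or.inr (Or.inl (single _ 4 fun R _ s a ha => by simp [moveTable]))
  · exact Or.inr (Or.inl (single _ 0 fun R _ s a ha => by
      simp [moveTable]; linear_combination ha))
  · exact Or.inr (Or.inr (pair _ 1 2 (by decide) fun R _ s a ha => by simp [moveTable]; ring))
  · exact Or.inr (Or.inr (pair _ 1 3 (by decide) fun R _ s a ha => by simp [moveTable]; ring))
  · exact Or.inr (Or.inr (pair _ 1 4 (by decide) fun R _ s a ha => by simp [moveTable]; ring))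
  · exact Or.inr (Or.inr (pair _ 2 3 (by decide) fun R _ s a ha => by simp [moveTable]; ring))
  · exact Or.inr (Or.inr (pair _ 2 4 (by decide) fun R _ s a ha => by simp [moveTable]; ring))
  · exact Or.inr (Or.inr (pair _ 3 4 (by decide) fun R _ s a ha => by simp [moveTable]; ring))
  · exact Or.inr (Or.inr (pair _ 0 1 (by decide) fun R _ s a ha => by
      simp [moveTable]; linear_combination -ha))
  · exact Or.inr (Or.inr (pair _ 0 2 (by decide) fun R _ s a ha => by
      simp [moveTable]; linear_combination -ha))
  · exact Or.inr (Or.inr (pair _ 0 3 (by decide) fun R _ s a ha => by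
      simp [moveTable]; linear_combination -ha))
  · exact Or.inr (Or.inr (pair _ 0 4 (by decide) fun R _ s a ha => by
      simp [moveTable]; linear_combination -ha))

/-- The parameter belonging to a three-dimensional face. -/
def faceParameter (F : Finset (Fin 4)) : Fin 5 :=
  if 0 ∉ F then 1 else if 1 ∉ F then 2 else if 2 ∉ F then 3 else if 3 ∉ F then 4 else 0

variable {Δ : Set (Finset (Fin 4))}

theorem margin_moveTable {R : Type*} [CommRing R] (s : R) (a : Fin 5 → R) {F : Finset (Fin 4)}
    (hF : F ≠ univ) (hs : F.card = 3 → a (faceParameter F) = s) (x : Cell twoTwoTwoTwo) :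
    margin F (moveTable s a) x = 0 := by
  have key : ∀ G : Finset (Fin 4), F ⊆ G →
      (∀ p q r t : Fin 2, margin G (moveTable s a) ![p, q, r, t] = 0) →
      margin F (moveTable s a) x = 0 := by
    intro G hFG hG
    rw [margin_eq_of_subset hFG (v := 0) fun y => ?_]
    · simp [margin]
    · rw [eq_vec y, hG]; simp [margin]
  have hF' : ∀ F : Finset (Fin 4), F ≠ univ → F ⊆ {0, 1} ∨ F ⊆ {0, 2} ∨ F ⊆ {0, 3} ∨ F ⊆ {1, 2} ∨
      F ⊆ {1, 3} ∨ F ⊆ {2, 3} ∨ F = {0, 1, 2} ∨ F = {0, 1, 3} ∨ F = {0, 2, 3} ∨ F = {1, 2, 3} := by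
    decide
  rcases hF' F hF with h | h | h | h | h | h | rfl | rfl | rfl | rfl
  · refine key _ h fun p q r t => ?_
    rw [margin_pair01]; fin_cases p <;> fin_cases q <;> simp [moveTable] <;> ring
  · refine key _ h fun p q r t => ?_
    rw [margin_pair02]; fin_cases p <;> fin_cases r <;> simp [moveTable] <;> ring
  · refine key _ h fun p q r t => ?_
    rw [margin_pair03]; fin_cases p <;> fin_cases t <;> simp [moveTable] <;> ring
  · refine key _ h fun p q r t => ?_
    rw [margin_pair12]; fin_cases q <;> fin_cases r <;> simp [moveTable] <;> ring
  · refine key _ h fun p q r t => ?_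
    rw [margin_pair13]; fin_cases q <;> fin_cases t <;> simp [moveTable] <;> ring
  · refine key _ h fun p q r t => ?_
    rw [margin_pair23]; fin_cases r <;> fin_cases t <;> simp [moveTable] <;> ring
  -- A triple marginal sums two cells differing in one coordinate; up to sign the sum is `s` minus
  -- the parameter of that coordinate.
  · have : a 4 = s := hs (by decide)
    refine key _ subset_rfl fun p q r t => ?_
    rw [margin_triple012]; fin_cases p <;> fin_cases q <;> fin_cases r <;> simp [moveTable, this]
  · have : a 3 = s := hs (by decide)
    refine key _ subset_rfl fun p q r t => ?_
    rw [margin_triple013]; fin_cases p <;> fin_cases q <;> fin_cases t <;> simp [moveTable, this]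
  · have : a 2 = s := hs (by decide)
    refine key _ subset_rfl fun p q r t => ?_
    rw [margin_triple023]; fin_cases p <;> fin_cases r <;> fin_cases t <;> simp [moveTable, this]
  · have : a 1 = s := hs (by decide)
    refine key _ subset_rfl fun p q r t => ?_
    rw [margin_triple123]; fin_cases q <;> fin_cases r <;> fin_cases t <;> simp [moveTable, this]

/-- The pair marginals determine the table from its first entry and the four entries at distance
one. The sum relation expresses the entry at `1111`, and a three-element face pairs the first cell
with one of these four neighbours. -/
theorem exists_eq_moveTable (hΔ : ∀ i j : Fin 4, i ≠ j → {i, j} ∈ Δ)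
    (w : Cell twoTwoTwoTwo → ℝ) (hw : ∀ F ∈ Δ, ∀ x, margin F w x = 0) :
    ∃ a : Fin 5 → ℝ, ∑ i, a i = 3 * w (fun _ => 0) ∧ w = moveTable (w fun _ => 0) a ∧
      (∀ F ∈ Δ, F.card = 3 → a (faceParameter F) = w fun _ => 0) := by
  have e01 := fun c e : Fin 2 => (margin_pair01 w c e 0 0).symm.trans (hw _ (hΔ 0 1 (by decide)) _)
  have e02 := fun c e : Fin 2 => (margin_pair02 w c 0 e 0).symm.trans (hw _ (hΔ 0 2 (by decide)) _)
  have e03 := fun c e : Fin 2 => (margin_pair03 w c 0 0 e).symm.trans (hw _ (hΔ 0 3 (by decide)) _)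
  have e12 := fun c e : Fin 2 => (margin_pair12 w 0 c e 0).symm.trans (hw _ (hΔ 1 2 (by decide)) _)
  have e13 := fun c e : Fin 2 => (margin_pair13 w 0 c 0 e).symm.trans (hw _ (hΔ 1 3 (by decide)) _)
  have e23 := fun c e : Fin 2 => (margin_pair23 w 0 0 c e).symm.trans (hw _ (hΔ 2 3 (by decide)) _)
  simp only [Fin.forall_fin_two, Fin.sum_univ_two] at e01 e02 e03 e12 e13 e23
  rw [eq_vec fun _ => 0]
  refine ⟨![-w ![(1 : Fin 2), 1, 1, 1], -w ![(1 : Fin 2), 0, 0, 0], -w ![(0 : Fin 2), 1, 0, 0], -w ![(0 : Fin 2), 0, 1, 0],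
    -w ![(0 : Fin 2), 0, 0, 1]], ?_, ?_, ?_⟩
  · simp [Fin.sum_univ_five]
    linarith
  · have : ∀ p q r t : Fin 2, w ![p, q, r, t] = moveTable (w ![(0 : Fin 2), 0, 0, 0]) ![-w ![(1 : Fin 2), 1, 1, 1],
        -w ![(1 : Fin 2), 0, 0, 0], -w ![(0 : Fin 2), 1, 0, 0], -w ![(0 : Fin 2), 0, 1, 0], -w ![(0 : Fin 2), 0, 0, 1]]
        ![p, q, r, t] := by
      intro p q r t
      fin_cases p <;> fin_cases q <;> fin_cases r <;> fin_cases t <;> simp [moveTable] <;> linarith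
    funext x
    rw [eq_vec x]
    exact this _ _ _ _
  · intro F hF hc
    have hF' : ∀ F : Finset (Fin 4), F.card = 3 →
        F = {0, 1, 2} ∨ F = {0, 1, 3} ∨ F = {0, 2, 3} ∨ F = {1, 2, 3} := by decide
    rcases hF' F hc with rfl | rfl | rfl | rfl
    · have := (margin_triple012 w 0 0 0 0).symm.trans (hw _ hF _)
      rw [Fin.sum_univ_two] at this
      rw [show faceParameter {0, 1, 2} = 4 by decide]
      simp
      linarith
    · have := (margin_triple013 w 0 0 0 0).symm.trans (hw _ hF _)
      rw [Fin.sum_univ_two] at this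
      rw [show faceParameter {0, 1, 3} = 3 by decide]
      simp
      linarith
    · have := (margin_triple023 w 0 0 0 0).symm.trans (hw _ hF _)
      rw [Fin.sum_univ_two] at this
      rw [show faceParameter {0, 2, 3} = 2 by decide]
      simp
      linarith
    · have := (margin_triple123 w 0 0 0 0).symm.trans (hw _ hF _)
      rw [Fin.sum_univ_two] at this
      rw [show faceParameter {1, 2, 3} = 1 by decide]
      simp
      linarith

end CompleteGraph

/-! ### Upper bounds, extremal tables and the proposition -/

section Gaps

variable {Δ : Set (Finset (Fin 4))}

open Classical in
/-- The parameters of the moves which are bound to the first entry by the three-dimensional faces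
of `Δ`. -/
noncomputable def boundParameters (Δ : Set (Finset (Fin 4))) : Finset (Fin 5) :=
  {i | ∃ F ∈ Δ, F.card = 3 ∧ faceParameter F = i}

theorem mem_boundParameters {i : Fin 5} :
    i ∈ boundParameters Δ ↔ ∃ F ∈ Δ, F.card = 3 ∧ faceParameter F = i := by
  simp [boundParameters]

theorem gapAtMost_of_complete (hΔ : ∀ i j : Fin 4, i ≠ j → {i, j} ∈ Δ) (huniv : univ ∉ Δ) {g : ℝ}
    (hg : 0 ≤ g) (h0 : boundParameters Δ = ∅ → 5 / 3 ≤ g)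
    (h1 : (boundParameters Δ).card = 1 → 1 ≤ g) : GapAtMost twoTwoTwoTwo univ Δ g := by
  refine gapAtMost_univ_of_exists_move fun w hw hlt => ?_
  obtain ⟨a, ha, hwa, haF⟩ := exists_eq_moveTable hΔ w hw
  obtain ⟨c, p, hc, hp, hcT, hsingle, hpair⟩ := exists_moveAvailable (T := boundParameters Δ) ha
    (fun i hi => by
      obtain ⟨F, hF, hF3, rfl⟩ := mem_boundParameters.1 hi
      exact haF F hF hF3)
    (by linarith) (fun h => by linarith [h0 h]) (fun h => by linarith [h1 h])
  refine ⟨moveTable p c, fun F hF x => margin_moveTable p c (fun h => huniv (h ▸ hF))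
    (fun hF3 => hcT _ (mem_boundParameters.2 ⟨F, hF, hF3, rfl⟩)) x, by simpa [moveTable] using hp,
    fun x => ?_⟩
  rcases moveTable_cases x with rfl | ⟨i, h⟩ | ⟨i, j, hij, h⟩
  · left; simpa [moveTable] using hp.le
  · rw [hwa, h ℝ _ a ha, h ℤ p c hc]
    rcases hsingle i with hi | hi
    · left; omega
    · right; push_cast; linarith
  · rw [hwa, h ℝ _ a ha, h ℤ p c hc]
    rcases hpair i j hij with hi | hi
    · left; omega
    · right; push_cast; linarith

/-- The table with entries `1` at the cells `1111` and `1000, 0100, 0010, 0001`. -/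
def fiveCells (x : Cell twoTwoTwoTwo) : ℤ :=
  if (x 0).val + (x 1).val + (x 2).val + (x 3).val ∈ ({1, 4} : Finset ℕ) then 1 else 0

theorem fiveCells_nonneg (x : Cell twoTwoTwoTwo) : 0 ≤ fiveCells x := by
  unfold fiveCells; split_ifs <;> simp

/-- In the parameters of the difference, nonnegativity means `a i ≤ 1` and `a i + a j ≥ s`. Since `∑
a i = 3 s ≤ 5`, an integral `s > 0` must be `1`. Then at most one `a i` is nonpositive, so the
others equal `1` and it equals `-1`, violating the pair condition. -/
theorem fiveCells_optimal (hΔ : ∀ i j : Fin 4, i ≠ j → {i, j} ∈ Δ) (u : Cell twoTwoTwoTwo → ℤ)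
    (hu : ∀ x, 0 ≤ u x) (hm : ∀ F ∈ Δ, ∀ x, margin F u x = margin F fiveCells x) :
    u (fun _ => 0) ≤ fiveCells (fun _ => 0) := by
  have e01 := fun c e : Fin 2 => hm _ (hΔ 0 1 (by decide)) ![c, e, 0, 0]
  have e02 := fun c e : Fin 2 => hm _ (hΔ 0 2 (by decide)) ![c, 0, e, 0]
  have e03 := fun c e : Fin 2 => hm _ (hΔ 0 3 (by decide)) ![c, 0, 0, e]
  have e12 := fun c e : Fin 2 => hm _ (hΔ 1 2 (by decide)) ![0, c, e, 0]
  have e13 := fun c e : Fin 2 => hm _ (hΔ 1 3 (by decide)) ![0, c, 0, e]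
  have e23 := fun c e : Fin 2 => hm _ (hΔ 2 3 (by decide)) ![0, 0, c, e]
  simp only [margin_pair01] at e01
  simp only [margin_pair02] at e02
  simp only [margin_pair03] at e03
  simp only [margin_pair12] at e12
  simp only [margin_pair13] at e13
  simp only [margin_pair23] at e23
  have hpos := fun p q r t : Fin 2 => hu ![p, q, r, t]
  rw [eq_vec fun _ => 0]
  simp only [Fin.forall_fin_two, Fin.sum_univ_two] at e01 e02 e03 e12 e13 e23 hpos
  simp [fiveCells] at e01 e02 e03 e12 e13 e23 hpos ⊢
  -- The marginals confine these entries to `0` and `1`; splitting on them leaves cases that `omega`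
  -- can settle.
  have h₁ : u ![(1 : Fin 2), 1, 1, 1] = 0 ∨ u ![(1 : Fin 2), 1, 1, 1] = 1 := by omega
  have h₂ : u ![(0 : Fin 2), 1, 1, 1] = 0 ∨ u ![(0 : Fin 2), 1, 1, 1] = 1 := by omega
  have h₃ : u ![(1 : Fin 2), 0, 1, 1] = 0 ∨ u ![(1 : Fin 2), 0, 1, 1] = 1 := by omega
  omega

theorem isGreatest_of_complete {𝓕 : Finset (Finset (Fin 4))}
    (h𝓕 : ∀ i j : Fin 4, i ≠ j → {i, j} ∈ lowerClosure (𝓕 : Set (Finset (Fin 4))))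
    (huniv : univ ∉ lowerClosure (𝓕 : Set (Finset (Fin 4)))) {g : ℝ} {a : Fin 5 → ℝ}
    (hface : ∀ F ∈ lowerClosure (𝓕 : Set (Finset (Fin 4))), F.card = 3 → a (faceParameter F) = g)
    (hg : GapAtMost twoTwoTwoTwo univ (lowerClosure (𝓕 : Set (Finset (Fin 4)))) g)
    (hpos : ∀ p q r t : Fin 2, 0 ≤ (fiveCells ![p, q, r, t] : ℝ) + moveTable g a ![p, q, r, t]) :
    IsGreatest (gapSet (modelMatrix twoTwoTwoTwo 𝓕) (maxFirstCellCost twoTwoTwoTwo)) g := by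
  refine hg.isGreatest fiveCells (fun x => (fiveCells x : ℝ) + moveTable g a x) fiveCells_nonneg
    (fun x => ?_) (fun F hF x => ?_) (fiveCells_optimal h𝓕) (by simp [fiveCells, moveTable])
  · rw [eq_vec x]; exact hpos _ _ _ _
  · rw [margin_add, margin_intCast,
      margin_moveTable g a (fun h => huniv (h ▸ hF)) (hface F hF), add_zero]

theorem isGreatest_five_thirds {𝓕 : Finset (Finset (Fin 4))}
    (h𝓕 : ∀ i j : Fin 4, i ≠ j → {i, j} ∈ lowerClosure (𝓕 : Set (Finset (Fin 4))))
    (huniv : univ ∉ lowerClosure (𝓕 : Set (Finset (Fin 4))))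
    (h0 : boundParameters (lowerClosure (𝓕 : Set (Finset (Fin 4)))) = ∅) :
    IsGreatest (gapSet (modelMatrix twoTwoTwoTwo 𝓕) (maxFirstCellCost twoTwoTwoTwo)) (5 / 3) := by
  -- Equality in `a i ≤ 1` everywhere gives `s = 5/3`: the real table has `5/3` in the first cell,
  -- `0` at the singleton cells and `1/3` at the ten pair cells.
  refine isGreatest_of_complete (a := fun _ => 1) h𝓕 huniv (fun F hF hF3 => ?_)
    (gapAtMost_of_complete h𝓕 huniv (by norm_num) (fun _ => le_rfl) fun h => ?_) ?_
  · have := mem_boundParameters.2 ⟨F, hF, hF3, rfl⟩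
    rw [h0] at this
    simp at this
  · simp [h0] at h
  · intro p q r t
    fin_cases p <;> fin_cases q <;> fin_cases r <;> fin_cases t <;>
      simp [fiveCells, moveTable] <;> norm_num

theorem isGreatest_one {𝓕 : Finset (Finset (Fin 4))}
    (h𝓕 : ∀ i j : Fin 4, i ≠ j → {i, j} ∈ lowerClosure (𝓕 : Set (Finset (Fin 4))))
    (huniv : univ ∉ lowerClosure (𝓕 : Set (Finset (Fin 4))))
    (h1 : (boundParameters (lowerClosure (𝓕 : Set (Finset (Fin 4))))).card = 1) :
    IsGreatest (gapSet (modelMatrix twoTwoTwoTwo 𝓕) (maxFirstCellCost twoTwoTwoTwo)) 1 := by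
  obtain ⟨m, hm⟩ := card_eq_one.1 h1
  -- The bound parameter equals `s = 1`, and the remaining `2` is spread evenly over the other four.
  refine isGreatest_of_complete (a := fun i => if i = m then 1 else 1 / 2) h𝓕 huniv
    (fun F hF hF3 => ?_)
    (gapAtMost_of_complete h𝓕 huniv (by norm_num) (fun h => ?_) fun h => le_rfl) ?_
  · have := mem_boundParameters.2 ⟨F, hF, hF3, rfl⟩
    rw [hm, mem_singleton] at this
    simp [this]
  · simp [h] at h1
  · clear hm
    intro p q r t
    fin_cases p <;> fin_cases q <;> fin_cases r <;> fin_cases t <;>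
      simp [fiveCells, moveTable] <;> fin_cases m <;> simp <;> norm_num

theorem exists_isGreatest_gapSet {𝓕 : Finset (Finset (Fin 4))} (h𝓕 : 𝓕.Nonempty) :
    ∃ g : ℝ, g ≤ 5 / 3 ∧
      IsGreatest (gapSet (modelMatrix twoTwoTwoTwo 𝓕) (maxFirstCellCost twoTwoTwoTwo)) g := by
  have hlow := (lowerClosure (𝓕 : Set (Finset (Fin 4)))).lower
  have h0 : ∅ ∈ lowerClosure (𝓕 : Set (Finset (Fin 4))) := by
    obtain ⟨F, hF⟩ := h𝓕
    exact ⟨F, hF, empty_subset F⟩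
  -- The full set as a face fixes the table. Otherwise the gap depends on whether the graph is
  -- complete and on the number of three-element faces.
  by_cases huniv : univ ∈ lowerClosure (𝓕 : Set (Finset (Fin 4)))
  · exact ⟨0, by norm_num, (gapAtMost_zero_of_mem huniv).isGreatest_zero h𝓕⟩
  by_cases hedge : ∀ i j : Fin 4, i ≠ j → {i, j} ∈ lowerClosure (𝓕 : Set (Finset (Fin 4)))
  · by_cases hb0 : boundParameters (lowerClosure (𝓕 : Set (Finset (Fin 4)))) = ∅
    · exact ⟨_, le_rfl, isGreatest_five_thirds hedge huniv hb0⟩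
    by_cases hb1 : (boundParameters (lowerClosure (𝓕 : Set (Finset (Fin 4))))).card = 1
    · exact ⟨1, by norm_num, isGreatest_one hedge huniv hb1⟩
    exact ⟨0, by norm_num, (gapAtMost_of_complete hedge huniv le_rfl (fun h => absurd h hb0)
      fun h => absurd h hb1).isGreatest_zero h𝓕⟩
  · push Not at hedge
    obtain ⟨i, j, hij, h⟩ := hedge
    exact ⟨0, by norm_num, (gapAtMost_zero_of_not_edge hlow h0 hij h).isGreatest_zero h𝓕⟩

theorem isGreatest_K4Model :
    IsGreatest (gapSet (modelMatrix twoTwoTwoTwo K4Model) (maxFirstCellCost twoTwoTwoTwo))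
      (5 / 3) := by
  have hcard : ∀ F ∈ lowerClosure (K4Model : Set (Finset (Fin 4))), F.card ≤ 2 := by
    rintro F ⟨G, hG, hFG⟩
    have : ∀ G ∈ K4Model, G.card ≤ 2 := by decide
    exact (card_le_card hFG).trans (this G hG)
  refine isGreatest_five_thirds (fun i j hij => subset_lowerClosure ?_)
    (fun h => absurd (hcard _ h) (by decide)) (eq_empty_of_forall_notMem fun i hi => ?_)
  · rw [mem_coe]; revert i j; decide
  · obtain ⟨F, hF, hF3, -⟩ := mem_boundParameters.1 hi
    have := hcard F hF
    omega

end Gaps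

theorem proposition4p2 :
    (∀ 𝓕 : Finset (Finset (Fin 4)), 𝓕.Nonempty →
      IsGreatest (gapSet (modelMatrix twoTwoTwoTwo 𝓕) (maxFirstCellCost twoTwoTwoTwo))
        (gapPlus twoTwoTwoTwo 𝓕) ∧
      gapPlus twoTwoTwoTwo 𝓕 ≤ 5 / 3) ∧
    gapPlus twoTwoTwoTwo K4Model = 5 / 3 := by
  refine ⟨fun 𝓕 h𝓕 => ?_, isGreatest_K4Model.csSup_eq⟩
  obtain ⟨g, hg, h⟩ := exists_isGreatest_gapSet h𝓕
  have : gapPlus twoTwoTwoTwo 𝓕 = g := h.csSup_eq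
  rw [this]
  exact ⟨h, hg⟩
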